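/- Let $N\ge 2$ be an integer, $0<T<\infty$ and $\nu\ge 0$. Let $L^2_\sigma(\mathbb R^N)$ be the space of vector fields in $[L^2(\mathbb R^N)]^N$ whose divergence vanishes in the sense of distributions, let $\mathcal S(\mathbb R^N)$ be the Schwartz space with dual $\mathcal S'(\mathbb R^N)$ and pairing $\langle\cdot,\cdot\rangle$, and let $p\in L^1(0,T;\mathcal S'(\mathbb R^N))$ mean that $t\mapsto\langle p(t),\psi\rangle$ is integrable on $(0,T)$ for every $\psi\in\mathcal S(\mathbb R^N)$. A pair $(v,p)\in L^1(0,T;L^2_\sigma(\mathbb R^N))\times L^1(0,T;\mathcal S'(\mathbb R^N))$ is called a weak solution of the Navier–Stokes equations with viscosity $\nu$ (of the Euler equations if $\nu=0$) on $\mathbb R^N\times(0,T)$ if for all $\phi\in[C_0^\infty(\mathbb R^N)]^N$ and all $\xi\in C^1_0(0,T)$ (compactly supported in $(0,T)$) the function $t\mapsto \xi(t)\int_{\mathbb R^N} v(x,t)\otimes v(x,t):\nabla\phi(x)\,dx$ is integrable on $(0,T)$ and $$-\int_0^T\!\!\int_{\mathbb R^N} v\cdot\phi\,\xi'(t)\,dx\,dt-\int_0^T\!\!\int_{\mathbb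 R^N} v\otimes v:\nabla\phi\,\xi(t)\,dx\,dt=\int_0^T\langle p(t),\operatorname{div}\phi\rangle\,\xi(t)\,dt+\nu\int_0^T\!\!\int_{\mathbb R^N} v\cdot\Delta\phi\,\xi(t)\,dx\,dt .$$ Fix $\varphi\in\mathcal S(\mathbb R^N)$ real-valued with $\int_{\mathbb R^N}\varphi\,dx\ne 0$, and set $\varphi_s(x)=s^{-N}\varphi(s^{-1}x)$ for $s>0$. For $0<q\le 1$ let $\mathcal H^q(\mathbb R^N)$ be the Hardy space of those $f\in\mathcal S'(\mathbb R^N)$ for which $\mathcal M_\varphi f(x):=\sup_{s>0}|f*\varphi_s(x)|$ belongs to $L^q(\mathbb R^N)$, with $\|f\|_{\mathcal H^q}:=\|\mathcal M_\varphi f\|_{L^q}$. Theorem 1.1. Let $(v,p)$ be a weak solution of the Navier–Stokes equations ($\nu>0$) or the Euler equations ($\nu=0$) on $\mathbb R^N\times(0,T)$. (i) (Liouville property) Suppose that either $p\in L^1(0,T;L^1(\mathbb R^N))$ with $\int_{\mathbb R^N}p(x,t)\,dx\ge 0$ for a.e. $t\in(0,T)$, or $p\in L^1(0,T;\mathcal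 H^q(\mathbb R^N))$ for some $q\in(0,1]$. Then $v(x,t)=0$ for a.e. $(x,t)\in\mathbb R^N\times(0,T)$. (ii) (Equipartition of energy) Suppose that $p\in L^1(0,T;L^1(\mathbb R^N))$ with $\int_{\mathbb R^N}p(x,t)\,dx\le 0$ for a.e. $t\in(0,T)$. Then for a.e. $t\in(0,T)$ $$\frac12\int_{\mathbb R^N}(v^j(x,t))^2\,dx=-\frac12\int_{\mathbb R^N}p(x,t)\,dx\quad\text{for all } j\in\{1,\dots,N\},$$ and $\int_{\mathbb R^N}v^j(x,t)\,v^k(x,t)\,dx=0$ for all $j,k\in\{1,\dots,N\}$ with $j\neq k$. -/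

import Mathlib

open MeasureTheory Set
open scoped ENNReal SchwartzMap LineDeriv

namespace NavierStokes

noncomputable section

/-- The Euclidean space `ℝ^N`. -/
abbrev Space (N : ℕ) : Type := EuclideanSpace ℝ (Fin N)

/-- Real tempered distributions on `ℝ^N`: continuous linear functionals on the Schwartz space. -/
abbrev Tempered (N : ℕ) : Type := 𝓢(Space N, ℝ) →L[ℝ] ℝ

/-- Lebesgue measure on `(0, T)`. -/
def timeMeasure (T : ℝ) : Measure ℝ := volume.restrict (Ioo 0 T)

/-- The partial derivative `∂_i f` of a Schwartz function, again a Schwartz function. -/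
def pd {N : ℕ} (i : Fin N) (f : 𝓢(Space N, ℝ)) : 𝓢(Space N, ℝ) :=
  ∂_{(EuclideanSpace.single i (1 : ℝ) : Space N)} f

/-- The divergence `∑ i, ∂_i φ^i` of a vector field with Schwartz components. -/
def divergence {N : ℕ} (φ : Fin N → 𝓢(Space N, ℝ)) : 𝓢(Space N, ℝ) :=
  ∑ i, pd i (φ i)

/-- The Laplacian `∑ i, ∂_i ∂_i f`. -/
def lap {N : ℕ} (f : 𝓢(Space N, ℝ)) : 𝓢(Space N, ℝ) :=
  ∑ i, pd i (pd i f)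

/-- `f ∈ L¹(0,T; L^q(ℝ^N; F))`, for a function `f = f(t)(x)` of time and space. -/
def MemL1Lq {N : ℕ} {F : Type*} [NormedAddCommGroup F] (T : ℝ) (q : ℝ≥0∞)
    (f : ℝ → Space N → F) : Prop :=
  AEStronglyMeasurable (Function.uncurry f) ((timeMeasure T).prod volume) ∧
    ∫⁻ t, eLpNorm (f t) q volume ∂(timeMeasure T) < ∞

/-- `div u = 0` in the sense of distributions. The functions in `C_0^∞(ℝ^N)` are exactly the
Schwartz functions with compact support. -/
def IsDivFree {N : ℕ} (u : Space N → Space N) : Prop :=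
  ∀ ψ : 𝓢(Space N, ℝ), HasCompactSupport ψ → (∫ x, ∑ i, u x i * pd i ψ x) = 0

/-- `p ∈ L¹(0,T; 𝓢'(ℝ^N))`: every pairing `t ↦ ⟨p(t), ψ⟩` is integrable on `(0,T)`. -/
def MemL1Tempered {N : ℕ} (T : ℝ) (p : ℝ → Tempered N) : Prop :=
  ∀ ψ : 𝓢(Space N, ℝ), Integrable (fun t => p t ψ) (timeMeasure T)

/-- Weak solutions `(v, p)` of the Navier–Stokes equations with viscosity `ν` (the Euler equations
if `ν = 0`) on `ℝ^N × (0,T)`. The test functions are `φ ∈ [C_0^∞(ℝ^N)]^N` and `ξ ∈ C_0^1(0,T)`.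
The quadratic term need not be integrable in time for `v ∈ L¹(0,T; L²)`, so its integrability is
required here; the other three integrals in the weak formulation always exist. -/
structure IsWeakSolution {N : ℕ} (ν T : ℝ) (v : ℝ → Space N → Space N) (p : ℝ → Tempered N) :
    Prop where
  memL1L2 : MemL1Lq T 2 v
  divFree : ∀ᵐ t ∂(timeMeasure T), IsDivFree (v t)
  pressure : MemL1Tempered T p
  integrable_quadratic : ∀ (φ : Fin N → 𝓢(Space N, ℝ)) (ξ : ℝ → ℝ),
    (∀ j, HasCompactSupport (φ j)) →
    ContDiff ℝ 1 ξ → HasCompactSupport ξ → tsupport ξ ⊆ Ioo 0 T →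
    Integrable (fun t => (∫ x, ∑ i, ∑ j, v t x i * v t x j * pd i (φ j) x) * ξ t) (timeMeasure T)
  weak_formulation : ∀ (φ : Fin N → 𝓢(Space N, ℝ)) (ξ : ℝ → ℝ),
    (∀ j, HasCompactSupport (φ j)) →
    ContDiff ℝ 1 ξ → HasCompactSupport ξ → tsupport ξ ⊆ Ioo 0 T →
    - (∫ t, (∫ x, ∑ j, v t x j * φ j x) * deriv ξ t ∂(timeMeasure T))
      - ∫ t, (∫ x, ∑ i, ∑ j, v t x i * v t x j * pd i (φ j) x) * ξ t ∂(timeMeasure T)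
    = (∫ t, p t (divergence φ) * ξ t ∂(timeMeasure T))
      + ν * ∫ t, (∫ x, ∑ j, v t x j * lap (φ j) x) * ξ t ∂(timeMeasure T)

/-- The `j`-th component `½ ∫ (v^j(x,t))² dx` of the energy at time `t`. -/
def energy {N : ℕ} (v : ℝ → Space N → Space N) (j : Fin N) (t : ℝ) : ℝ :=
  (1 / 2) * ∫ x, (v t x j) ^ 2

/-- `p ∈ L¹(0,T; L¹(ℝ^N))`, and `p` is given by the function `P = P(t)(x)`. -/
def IsL1L1Density {N : ℕ} (T : ℝ) (p : ℝ → Tempered N) (P : ℝ → Space N → ℝ) : Prop :=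
  MemL1Lq T 1 P ∧
    ∀ᵐ t ∂(timeMeasure T), ∀ ψ : 𝓢(Space N, ℝ), p t ψ = ∫ x, P t x * ψ x

/-- The Schwartz function `y ↦ φ_s(x - y)`, where `φ_s(z) = s^{-N} φ(s⁻¹ z)` and `s > 0`. -/
def dilatedKernel {N : ℕ} (φ : 𝓢(Space N, ℝ)) (s : ℝ) (hs : 0 < s) (x : Space N) :
    𝓢(Space N, ℝ) :=
  (s ^ N)⁻¹ • SchwartzMap.compSubConstCLM ℝ x
    (SchwartzMap.compCLMOfContinuousLinearEquiv ℝ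
      (ContinuousLinearEquiv.smulLeft
        (Units.mk0 (-s⁻¹) (neg_ne_zero.mpr (inv_ne_zero hs.ne')))) φ)

theorem dilatedKernel_apply {N : ℕ} (φ : 𝓢(Space N, ℝ)) (s : ℝ) (hs : 0 < s) (x y : Space N) :
    dilatedKernel φ s hs x y = (s ^ N)⁻¹ * φ (s⁻¹ • (x - y)) := by
  have h : (-s⁻¹) • (y - x) = s⁻¹ • (x - y) := by rw [neg_smul, ← smul_neg, neg_sub]
  rw [← h]
  rfl

/-- The maximal function `𝓜_φ f(x) = sup_{s > 0} |(f * φ_s)(x)|` of a tempered distribution, where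
`(f * φ_s)(x) = ⟨f, φ_s(x - ·)⟩`. -/
def maximalFunction {N : ℕ} (φ : 𝓢(Space N, ℝ)) (f : Tempered N) (x : Space N) : ℝ≥0∞ :=
  ⨆ (s : ℝ) (hs : 0 < s), ENNReal.ofReal |f (dilatedKernel φ s hs x)|

/-- The Hardy quasi-norm `‖f‖_{𝓗^q} = ‖𝓜_φ f‖_{L^q}`. -/
def hardyNorm {N : ℕ} (φ : 𝓢(Space N, ℝ)) (q : ℝ) (f : Tempered N) : ℝ≥0∞ :=
  (∫⁻ x, maximalFunction φ f x ^ q) ^ (1 / q)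

/-- The Hardy space `𝓗^q(ℝ^N)`, defined with the Schwartz function `φ`. -/
def hardySpace {N : ℕ} (φ : 𝓢(Space N, ℝ)) (q : ℝ) : Set (Tempered N) :=
  {f | hardyNorm φ q f < ∞}

/-- `p ∈ L¹(0,T; 𝓗^q(ℝ^N))`. -/
def MemL1Hardy {N : ℕ} (φ : 𝓢(Space N, ℝ)) (q T : ℝ) (p : ℝ → Tempered N) : Prop :=
  MemL1Tempered T p ∧ (∀ᵐ t ∂(timeMeasure T), p t ∈ hardySpace φ q) ∧
    ∫⁻ t, hardyNorm φ q (p t) ∂(timeMeasure T) < ∞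

end

end NavierStokes

open NavierStokes

/-!
Testing the equation with gradients `φ = ∇ψ` removes the time derivative and the viscous term, so
that for almost every `t` the pressure satisfies `-Δp = ∑ᵢⱼ ∂ᵢ∂ⱼ(vⁱvʲ)` with `vⁱvʲ ∈ L¹`.

If `p ∈ L¹`, insert `ψ(x / R)` with `ψ` a quadratic form near the origin and let `R → ∞`: this gives
`∫ vᵏvˡ = -δ_kl ∫ p`.

If `p ∈ 𝓗^q`, the functions `u_R(x) = R^N (p * φ_R)(R x)` satisfy `|u_R(x)| ≤ R^N 𝓜_φ p(R x)`.
Since `q ≤ 1`, their `L^q` norms are bounded, and those over `{|x| > ρ}` tend to `0` as `R → ∞`. By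
the pressure equation `Δu_R` is bounded and tends to `-∑ᵢⱼ cᵢⱼ ∂ᵢ∂ⱼφ` with `cᵢⱼ = ∫ vⁱvʲ`. The mean
value inequality and an argument of Hardy and Littlewood turn the `L^q` bound into a uniform bound,
so `u_R → 0` as a distribution away from the origin. Hence `∑ᵢⱼ cᵢⱼ ∂ᵢ∂ⱼφ = 0`, and `∫ φ ≠ 0` forces
`c_kk = 0` for every `k`.
-/

namespace NavierStokes

open Filter Topology
open scoped Laplacian

noncomputable section

variable {N : ℕ}

/-! ### Compactly supported functions in the Schwartz space -/

section Schwartz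

variable {E F : Type*} [NormedAddCommGroup E] [NormedSpace ℝ E]
  [NormedAddCommGroup F] [NormedSpace ℝ F]

/-- The dilation `ψ ↦ ψ(c ·)` of Schwartz functions. -/
def dilation (c : ℝ) (hc : c ≠ 0) : 𝓢(E, F) →L[ℝ] 𝓢(E, F) :=
  SchwartzMap.compCLMOfContinuousLinearEquiv ℝ
    (ContinuousLinearEquiv.smulLeft (Units.mk0 c hc))

@[simp]
theorem dilation_apply (c : ℝ) (hc : c ≠ 0) (ψ : 𝓢(E, F)) (x : E) :
    dilation c hc ψ x = ψ (c • x) := rfl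

theorem norm_iteratedFDeriv_dilation_le {c : ℝ} (hc : c ≠ 0) (hc1 : |c| ≤ 1) (χ : 𝓢(E, F))
    (i : ℕ) (x : E) :
    ‖iteratedFDeriv ℝ i (dilation c hc χ) x‖ ≤ SchwartzMap.seminorm ℝ 0 i χ := by
  have hL : ‖c • ContinuousLinearMap.id ℝ E‖ ≤ 1 := by
    rw [norm_smul]
    exact mul_le_one₀ hc1 (norm_nonneg _) ContinuousLinearMap.norm_id_le
  have h : (dilation c hc χ : E → F) = χ ∘ (c • ContinuousLinearMap.id ℝ E) := rfl
  rw [h, ContinuousLinearMap.iteratedFDeriv_comp_right _ (χ.smooth ⊤) x (by exact_mod_cast le_top)]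
  calc _ ≤ _ := ContinuousMultilinearMap.norm_compContinuousLinearMap_le _ _
    _ ≤ ‖iteratedFDeriv ℝ i χ ((c • ContinuousLinearMap.id ℝ E) x)‖ :=
      mul_le_of_le_one_right (norm_nonneg _)
        (Finset.prod_le_one (fun _ _ => norm_nonneg _) fun _ _ => hL)
    _ ≤ _ := SchwartzMap.norm_iteratedFDeriv_le_seminorm ℝ χ i _

section Cutoff

variable [FiniteDimensional ℝ E]

/-- A smooth compactly supported function equal to `1` on the unit ball. -/
def bump (E : Type*) [NormedAddCommGroup E] [NormedSpace ℝ E] [FiniteDimensional ℝ E] : 𝓢(E, ℝ) :=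
  let b : ContDiffBump (0 : E) := ⟨1, 2, one_pos, one_lt_two⟩
  b.hasCompactSupport.toSchwartzMap b.contDiff

theorem hasCompactSupport_bump : HasCompactSupport (bump E) :=
  ContDiffBump.hasCompactSupport (⟨1, 2, one_pos, one_lt_two⟩ : ContDiffBump (0 : E))

theorem bump_eq_one {x : E} (hx : ‖x‖ ≤ 1) : bump E x = 1 :=
  ContDiffBump.one_of_mem_closedBall (⟨1, 2, one_pos, one_lt_two⟩ : ContDiffBump (0 : E))
    (by simpa using hx)

/-- The cut-off of a Schwartz function at scale `n + 1`. -/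
def cutoff (n : ℕ) (ψ : 𝓢(E, F)) : 𝓢(E, F) :=
  SchwartzMap.smulLeftCLM F (dilation ((n : ℝ) + 1)⁻¹ (by positivity) (bump E)) ψ

theorem cutoff_apply (n : ℕ) (ψ : 𝓢(E, F)) (x : E) :
    cutoff n ψ x = dilation ((n : ℝ) + 1)⁻¹ (by positivity) (bump E) x • ψ x :=
  SchwartzMap.smulLeftCLM_apply_apply (SchwartzMap.hasTemperateGrowth _) _ _

theorem hasCompactSupport_cutoff (n : ℕ) (ψ : 𝓢(E, F)) : HasCompactSupport (cutoff n ψ) := by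
  have hbump : HasCompactSupport (dilation ((n : ℝ) + 1)⁻¹ (by positivity) (bump E)) :=
    hasCompactSupport_bump.comp_homeomorph (ContinuousLinearEquiv.smulLeft (R₁ := ℝ) (M₁ := E)
      (Units.mk0 ((n : ℝ) + 1)⁻¹ (by positivity))).toHomeomorph
  exact hbump.mono' (subset_tsupport _ |>.trans <|
    (SchwartzMap.tsupport_smulLeftCLM_subset _ _).trans inter_subset_right)

theorem cutoff_sub_eventuallyEq_zero (n : ℕ) (ψ : 𝓢(E, F)) {x : E} (hx : ‖x‖ < n + 1) :
    (cutoff n ψ - ψ : 𝓢(E, F)) =ᶠ[𝓝 x] 0 := by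
  filter_upwards [(isOpen_lt continuous_norm continuous_const).mem_nhds hx] with y hy
  have hn : (0 : ℝ) < (n : ℝ) + 1 := by positivity
  have hy1 : ‖((n : ℝ) + 1)⁻¹ • y‖ ≤ 1 := by
    rw [norm_smul, norm_inv, Real.norm_of_nonneg hn.le, inv_mul_le_iff₀ hn, mul_one]
    exact hy.le
  simp [cutoff_apply, bump_eq_one hy1]

theorem norm_iteratedFDeriv_cutoff_sub_le (m n : ℕ) (ψ : 𝓢(E, F)) (x : E) :
    ‖iteratedFDeriv ℝ m (cutoff n ψ - ψ : 𝓢(E, F)) x‖ ≤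
      (∑ i ∈ Finset.range (m + 1), (m.choose i : ℝ) * SchwartzMap.seminorm ℝ 0 i (bump E) *
        ‖iteratedFDeriv ℝ (m - i) ψ x‖) + ‖iteratedFDeriv ℝ m ψ x‖ := by
  have hc : |((n : ℝ) + 1)⁻¹| ≤ 1 := by
    rw [abs_of_pos (by positivity)]
    exact inv_le_one_of_one_le₀ (by simp)
  have hfun : ((cutoff n ψ - ψ : 𝓢(E, F)) : E → F) =
      (fun y => dilation ((n : ℝ) + 1)⁻¹ (by positivity) (bump E) y • ψ y) - ψ := by
    funext y
    simp only [sub_apply, Pi.sub_apply, cutoff_apply]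
  have hsmul : ContDiff ℝ m
      (fun y => dilation ((n : ℝ) + 1)⁻¹ (by positivity) (bump E) y • ψ y) :=
    (SchwartzMap.smooth _ m).smul (ψ.smooth m)
  rw [hfun, iteratedFDeriv_sub_apply hsmul.contDiffAt (ψ.smooth m).contDiffAt]
  refine (norm_sub_le _ _).trans (add_le_add_left ?_ _)
  refine (norm_iteratedFDeriv_smul_le (SchwartzMap.smooth _ m) (ψ.smooth m) x le_rfl).trans ?_
  gcongr
  exact norm_iteratedFDeriv_dilation_le _ hc _ _ _

theorem exists_seminorm_cutoff_sub_le (k m : ℕ) (ψ : 𝓢(E, F)) :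
    ∃ C : ℝ, ∀ n : ℕ, SchwartzMap.seminorm ℝ k m (cutoff n ψ - ψ) ≤ C / ((n : ℝ) + 1) := by
  let C : ℝ := (∑ i ∈ Finset.range (m + 1), (m.choose i : ℝ) * SchwartzMap.seminorm ℝ 0 i (bump E) *
    SchwartzMap.seminorm ℝ (k + 1) (m - i) ψ) + SchwartzMap.seminorm ℝ (k + 1) m ψ
  refine ⟨C, fun n => SchwartzMap.seminorm_le_bound ℝ k m _ (by positivity) fun x => ?_⟩
  have hn : (0 : ℝ) < (n : ℝ) + 1 := by positivity
  rcases lt_or_ge ‖x‖ ((n : ℝ) + 1) with hx | hx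
  · rw [((cutoff_sub_eventuallyEq_zero n ψ hx).iteratedFDeriv ℝ m).self_of_nhds]
    simp only [iteratedFDeriv_zero, Pi.zero_apply, norm_zero, mul_zero]
    positivity
  · -- For `‖x‖ ≥ n + 1` one more power of `‖x‖` pays for the factor `1 / (n + 1)`.
    rw [le_div_iff₀ hn]
    calc ‖x‖ ^ k * ‖iteratedFDeriv ℝ m (cutoff n ψ - ψ : 𝓢(E, F)) x‖ * ((n : ℝ) + 1)
        ≤ ‖x‖ ^ (k + 1) * ‖iteratedFDeriv ℝ m (cutoff n ψ - ψ : 𝓢(E, F)) x‖ := by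
          rw [mul_right_comm, pow_succ]
          gcongr
      _ ≤ ‖x‖ ^ (k + 1) * ((∑ i ∈ Finset.range (m + 1), (m.choose i : ℝ) *
            SchwartzMap.seminorm ℝ 0 i (bump E) * ‖iteratedFDeriv ℝ (m - i) ψ x‖) +
            ‖iteratedFDeriv ℝ m ψ x‖) := by
          gcongr
          exact norm_iteratedFDeriv_cutoff_sub_le m n ψ x
      _ = (∑ i ∈ Finset.range (m + 1), (m.choose i : ℝ) * SchwartzMap.seminorm ℝ 0 i (bump E) *
            (‖x‖ ^ (k + 1) * ‖iteratedFDeriv ℝ (m - i) ψ x‖)) +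
            ‖x‖ ^ (k + 1) * ‖iteratedFDeriv ℝ m ψ x‖ := by
          rw [mul_add, Finset.mul_sum]
          congr 1
          exact Finset.sum_congr rfl fun i _ => by ring
      _ ≤ C := by
          dsimp only [C]
          gcongr <;> exact SchwartzMap.le_seminorm ℝ _ _ ψ x

theorem tendsto_cutoff (ψ : 𝓢(E, F)) : Tendsto (fun n => cutoff n ψ) atTop (𝓝 ψ) := by
  rw [(schwartz_withSeminorms ℝ E F).tendsto_nhds]
  rintro ⟨k, m⟩ ε hε
  obtain ⟨C, hC⟩ := exists_seminorm_cutoff_sub_le k m ψ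
  have hlim : Tendsto (fun n : ℕ => C / ((n : ℝ) + 1)) atTop (𝓝 0) := by
    exact_mod_cast (tendsto_const_div_atTop_nhds_zero_nat C).comp (tendsto_add_atTop_nat 1)
  filter_upwards [hlim.eventually (gt_mem_nhds hε)] with n hn
  exact (hC n).trans_lt hn

end Cutoff

section Separability

/-- The jets `(ψ, Dψ, D²ψ, …)` of a Schwartz function, as continuous functions. -/
def jet (ψ : 𝓢(E, F)) (m : ℕ) : C(E, E [×m]→L[ℝ] F) :=
  ⟨iteratedFDeriv ℝ m ψ, (ψ.smooth m).continuous_iteratedFDeriv le_rfl⟩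

theorem finiteDimensional_continuousMultilinearMap [FiniteDimensional ℝ E] [FiniteDimensional ℝ F]
    (m : ℕ) : FiniteDimensional ℝ (E [×m]→L[ℝ] F) :=
  Module.Finite.of_injective
    (ContinuousMultilinearMap.toMultilinearMapLinear (R' := ℝ) :
      (E [×m]→L[ℝ] F) →ₗ[ℝ] MultilinearMap ℝ (fun _ : Fin m => E) F)
    ContinuousMultilinearMap.toMultilinearMap_injective

theorem seminorm_le_of_tsupport_subset_closedBall {R δ : ℝ} (hR : 0 ≤ R) (hδ : 0 ≤ δ) (k m : ℕ)
    {ψ : 𝓢(E, F)} (hψ : tsupport ψ ⊆ Metric.closedBall 0 R)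
    (h : ∀ x ∈ Metric.closedBall (0 : E) R, ‖iteratedFDeriv ℝ m ψ x‖ ≤ δ) :
    SchwartzMap.seminorm ℝ k m ψ ≤ R ^ k * δ := by
  refine SchwartzMap.seminorm_le_bound ℝ k m _ (by positivity) fun x => ?_
  by_cases hx : x ∈ Metric.closedBall (0 : E) R
  · have hxR : ‖x‖ ≤ R := by simpa using hx
    gcongr
    exact h x hx
  · have hx0 : iteratedFDeriv ℝ m ψ x = 0 :=
      image_eq_zero_of_notMem_tsupport fun hx' =>
        hx (hψ (tsupport_iteratedFDeriv_subset m hx'))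
    rw [hx0, norm_zero, mul_zero]
    positivity

theorem continuous_of_induced_jet [FiniteDimensional ℝ E] {R : ℝ} (hR : 0 ≤ R) :
    Continuous[.induced
      (fun ψ : {ψ : 𝓢(E, F) // tsupport ψ ⊆ Metric.closedBall 0 R} => jet ψ.1) inferInstance,
      inferInstance] Subtype.val := by
  let K := {ψ : 𝓢(E, F) // tsupport ψ ⊆ Metric.closedBall 0 R}
  let _ : TopologicalSpace K := .induced (fun ψ : K => jet ψ.1) inferInstance
  rw [continuous_iff_continuousAt]
  rintro ψ₀
  unfold ContinuousAt
  rw [(schwartz_withSeminorms ℝ E F).tendsto_nhds]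
  rintro ⟨k, m⟩ ε hε
  have hjet : Tendsto (fun ψ : K => jet ψ.1 m) (𝓝 ψ₀) (𝓝 (jet ψ₀.1 m)) :=
    ((continuous_apply m).comp continuous_induced_dom).tendsto ψ₀
  rw [ContinuousMap.tendsto_iff_forall_isCompact_tendstoUniformlyOn] at hjet
  have hδ : 0 < ε / (R ^ k + 1) := by positivity
  filter_upwards [Metric.tendstoUniformlyOn_iff.1 (hjet _ (isCompact_closedBall 0 R)) _ hδ]
    with ψ hψ
  have hsupp : tsupport (ψ.1 - ψ₀.1 : 𝓢(E, F)) ⊆ Metric.closedBall 0 R :=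
    (tsupport_sub ψ.1 ψ₀.1).trans (union_subset ψ.2 ψ₀.2)
  refine (seminorm_le_of_tsupport_subset_closedBall hR hδ.le k m hsupp fun x hx => ?_).trans_lt ?_
  · have hsub : iteratedFDeriv ℝ m (ψ.1 - ψ₀.1 : 𝓢(E, F)) x = jet ψ.1 m x - jet ψ₀.1 m x :=
      iteratedFDeriv_sub_apply (ψ.1.smooth m).contDiffAt (ψ₀.1.smooth m).contDiffAt
    rw [hsub, ← dist_eq_norm, dist_comm]
    exact (hψ x hx).le
  · rw [← mul_div_assoc, div_lt_iff₀ (by positivity)]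
    linarith

theorem exists_countable_tsupport_subset_closedBall [FiniteDimensional ℝ E] [FiniteDimensional ℝ F]
    {R : ℝ} (hR : 0 ≤ R) :
    ∃ S ⊆ {ψ : 𝓢(E, F) | tsupport ψ ⊆ Metric.closedBall 0 R}, S.Countable ∧
      {ψ : 𝓢(E, F) | tsupport ψ ⊆ Metric.closedBall 0 R} ⊆ closure S := by
  let K := {ψ : 𝓢(E, F) // tsupport ψ ⊆ Metric.closedBall 0 R}
  let _ : TopologicalSpace K := .induced (fun ψ : K => jet ψ.1) inferInstance
  have (m : ℕ) : SecondCountableTopology (E [×m]→L[ℝ] F) :=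
    have := finiteDimensional_continuousMultilinearMap (E := E) (F := F) m
    have := FiniteDimensional.proper ℝ (E [×m]→L[ℝ] F)
    inferInstance
  have : SecondCountableTopology K := TopologicalSpace.secondCountableTopology_induced _ _ _
  obtain ⟨D, hDc, hD⟩ := TopologicalSpace.exists_countable_dense K
  refine ⟨Subtype.val '' D, ?_, hDc.image _, ?_⟩
  · rintro _ ⟨ψ, -, rfl⟩
    exact ψ.2
  · simpa using (continuous_of_induced_jet hR).range_subset_closure_image_dense hD

theorem exists_countable_dense_hasCompactSupport [FiniteDimensional ℝ E] [FiniteDimensional ℝ F] :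
    ∃ S : Set 𝓢(E, F), S.Countable ∧ Dense S ∧ ∀ ψ ∈ S, HasCompactSupport ψ := by
  choose S hSK hSc hSd using fun n : ℕ =>
    exists_countable_tsupport_subset_closedBall (E := E) (F := F) n.cast_nonneg
  refine ⟨⋃ n, S n, countable_iUnion hSc, fun ψ => ?_, fun ψ hψ => ?_⟩
  · have hcut (n : ℕ) : cutoff n ψ ∈ closure (⋃ n, S n) := by
      obtain ⟨r, hr⟩ := (hasCompactSupport_cutoff n ψ).isBounded.subset_closedBall 0
      obtain ⟨M, hM⟩ := exists_nat_ge r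
      exact closure_mono (subset_iUnion S M)
        (hSd M (hr.trans (Metric.closedBall_subset_closedBall hM)))
    exact isClosed_closure.mem_of_tendsto (tendsto_cutoff ψ) (.of_forall hcut)
  · obtain ⟨n, hn⟩ := mem_iUnion.1 hψ
    exact (isCompact_closedBall 0 (n : ℝ)).of_isClosed_subset (isClosed_tsupport _) (hSK n hn)

end Separability

end Schwartz

/-! ### Translations and convolution -/

theorem norm_sub_sub_le_of_norm_fderiv_fderiv_le {E F : Type*} [NormedAddCommGroup E]
    [NormedSpace ℝ E] [NormedAddCommGroup F] [NormedSpace ℝ F] {f : E → F} (hf : ContDiff ℝ 2 f)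
    {K : ℝ} {x h : E} (hK : ∀ z ∈ segment ℝ x (x + h), ‖fderiv ℝ (fderiv ℝ f) z‖ ≤ K) :
    ‖f (x + h) - f x - fderiv ℝ f x h‖ ≤ K * ‖h‖ ^ 2 := by
  have hf0 (z : E) : HasFDerivAt f (fderiv ℝ f z) z :=
    (hf.differentiable (by norm_num) z).hasFDerivAt
  have hf1 (z : E) : HasFDerivAt (fderiv ℝ f) (fderiv ℝ (fderiv ℝ f) z) z :=
    ((hf.fderiv_right (m := 1) (by norm_num)).differentiable (by norm_num) z).hasFDerivAt
  have hK0 : 0 ≤ K := (norm_nonneg (fderiv ℝ (fderiv ℝ f) x)).trans (hK x (left_mem_segment ℝ _ _))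
  have hderiv : ∀ z ∈ segment ℝ x (x + h), ‖fderiv ℝ f z - fderiv ℝ f x‖ ≤ K * ‖h‖ := by
    intro z hz
    refine ((convex_segment x (x + h)).norm_image_sub_le_of_norm_hasFDerivWithin_le
      (fun y _ => (hf1 y).hasFDerivWithinAt) hK (left_mem_segment ℝ _ _) hz).trans ?_
    gcongr
    simpa using norm_sub_le_of_mem_segment hz
  have := (convex_segment x (x + h)).norm_image_sub_le_of_norm_hasFDerivWithin_le'
    (fun y _ => (hf0 y).hasFDerivWithinAt) hderiv (left_mem_segment ℝ _ _)
    (right_mem_segment ℝ _ _)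
  rwa [add_sub_cancel_left, mul_assoc, ← sq] at this

universe u

section Translation

variable {E F : Type u} [NormedAddCommGroup E] [NormedSpace ℝ E]
  [NormedAddCommGroup F] [NormedSpace ℝ F]

theorem lineDerivOp_compSubConstCLM (h a : E) (ψ : 𝓢(E, F)) :
    ∂_{h} (SchwartzMap.compSubConstCLM ℝ a ψ) = SchwartzMap.compSubConstCLM ℝ a (∂_{h} ψ) := by
  ext x
  have hfun : (SchwartzMap.compSubConstCLM ℝ a ψ : E → F) = fun y => ψ (y - a) := rfl
  rw [SchwartzMap.lineDerivOp_apply_eq_fderiv, SchwartzMap.compSubConstCLM_apply,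
    SchwartzMap.lineDerivOp_apply_eq_fderiv, hfun, fderiv_comp_sub]

theorem lineDerivOp_apply_lineDerivOp (h k : E) (ψ : 𝓢(E, F)) (x : E) :
    (∂_{h} (∂_{k} ψ) : 𝓢(E, F)) x = fderiv ℝ (fderiv ℝ ψ) x h k := by
  have hk : ((∂_{k} ψ : 𝓢(E, F)) : E → F) = fun y => fderiv ℝ ψ y k :=
    funext fun y => SchwartzMap.lineDerivOp_apply_eq_fderiv _ _ _
  have hd : DifferentiableAt ℝ (fderiv ℝ ψ) x :=
    ((ψ.smooth 2).fderiv_right (m := 1) (by norm_num)).differentiable (by norm_num) x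
  rw [SchwartzMap.lineDerivOp_apply_eq_fderiv, hk,
    fderiv_clm_apply hd (differentiableAt_const _)]
  simp

theorem lineDerivOp_lineDerivOp_comm (h k : E) (ψ : 𝓢(E, F)) :
    (∂_{h} (∂_{k} ψ) : 𝓢(E, F)) = ∂_{k} (∂_{h} ψ) := by
  ext x
  rw [lineDerivOp_apply_lineDerivOp, lineDerivOp_apply_lineDerivOp]
  exact (ψ.smooth 2).contDiffAt.isSymmSndFDerivAt (by simp) h k

theorem fderivCLM_compSubConstCLM_sub_add_lineDerivOp (ψ : 𝓢(E, F)) (h : E) :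
    SchwartzMap.fderivCLM ℝ E F (SchwartzMap.compSubConstCLM ℝ h ψ - ψ + ∂_{h} ψ) =
      SchwartzMap.compSubConstCLM ℝ h (SchwartzMap.fderivCLM ℝ E F ψ) -
        SchwartzMap.fderivCLM ℝ E F ψ + ∂_{h} (SchwartzMap.fderivCLM ℝ E F ψ) := by
  have hcurry (θ : 𝓢(E, F)) (x k : E) : SchwartzMap.fderivCLM ℝ E F θ x k = ∂_{k} θ x := by
    rw [SchwartzMap.fderivCLM_apply, SchwartzMap.lineDerivOp_apply_eq_fderiv]
  ext x k
  have hh : (∂_{h} (SchwartzMap.fderivCLM ℝ E F ψ) : 𝓢(E, E →L[ℝ] F)) x k =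
      (∂_{h} (∂_{k} ψ) : 𝓢(E, F)) x := by
    rw [lineDerivOp_apply_lineDerivOp, SchwartzMap.lineDerivOp_apply_eq_fderiv]
    rfl
  rw [hcurry]
  simp only [add_apply, sub_apply, SchwartzMap.compSubConstCLM_apply, hcurry, hh,
    LineDeriv.lineDerivOp_add]
  rw [sub_eq_add_neg, LineDeriv.lineDerivOp_add, LineDeriv.lineDerivOp_neg,
    lineDerivOp_compSubConstCLM, lineDerivOp_lineDerivOp_comm k h]
  simp [sub_eq_add_neg]

theorem norm_pow_mul_le_of_norm_sub_le_one (k : ℕ) (θ : 𝓢(E, F)) {x z : E} (hz : ‖z - x‖ ≤ 1) :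
    ‖x‖ ^ k * ‖θ z‖ ≤ 2 ^ k * ((Finset.Iic (k, 0)).sup
      fun m : ℕ × ℕ => SchwartzMap.seminorm ℝ m.1 m.2) θ := by
  have hsup := SchwartzMap.one_add_le_sup_seminorm_apply (𝕜 := ℝ) (m := (k, 0)) (k := k) (n := 0)
    le_rfl le_rfl θ z
  rw [norm_iteratedFDeriv_zero] at hsup
  refine le_trans ?_ hsup
  gcongr
  calc ‖x‖ ≤ ‖x - z‖ + ‖z‖ := by simpa using norm_add_le (x - z) z
    _ ≤ 1 + ‖z‖ := by gcongr; rwa [norm_sub_rev]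

theorem isBigO_seminorm_zero_compSubConstCLM_sub_add (k : ℕ) (ψ : 𝓢(E, F)) :
    (fun h : E => SchwartzMap.seminorm ℝ k 0
      (SchwartzMap.compSubConstCLM ℝ h ψ - ψ + ∂_{h} ψ)) =O[𝓝 0] fun h => ‖h‖ ^ 2 := by
  let D2 := SchwartzMap.fderivCLM ℝ E _ (SchwartzMap.fderivCLM ℝ E F ψ)
  let C := 2 ^ k * ((Finset.Iic (k, 0)).sup
    fun m : ℕ × ℕ => SchwartzMap.seminorm ℝ m.1 m.2) D2
  refine Asymptotics.IsBigO.of_bound C ?_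
  filter_upwards [Metric.closedBall_mem_nhds (0 : E) one_pos] with h hh
  have hh1 : ‖h‖ ≤ 1 := by simpa using hh
  rw [Real.norm_of_nonneg (apply_nonneg _ _), norm_pow, norm_norm]
  refine SchwartzMap.seminorm_le_bound ℝ k 0 _ (by positivity) fun x => ?_
  rw [norm_iteratedFDeriv_zero]
  have hval : (SchwartzMap.compSubConstCLM ℝ h ψ - ψ + ∂_{h} ψ) x =
      ψ (x + -h) - ψ x - fderiv ℝ ψ x (-h) := by
    simp [SchwartzMap.compSubConstCLM_apply, SchwartzMap.lineDerivOp_apply_eq_fderiv,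
      sub_eq_add_neg]
  rw [hval]
  rcases (pow_nonneg (norm_nonneg x) k).eq_or_lt' with hx0 | hxpos
  · rw [hx0, zero_mul]
    positivity
  have hD2 : ∀ z ∈ segment ℝ x (x + -h), ‖fderiv ℝ (fderiv ℝ ψ) z‖ ≤ C / ‖x‖ ^ k := by
    intro z hz
    rw [le_div_iff₀' hxpos]
    refine norm_pow_mul_le_of_norm_sub_le_one k D2 ?_
    exact (by simpa using norm_sub_le_of_mem_segment hz : ‖z - x‖ ≤ ‖h‖).trans hh1
  calc ‖x‖ ^ k * ‖ψ (x + -h) - ψ x - fderiv ℝ ψ x (-h)‖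
      ≤ ‖x‖ ^ k * (C / ‖x‖ ^ k * ‖-h‖ ^ 2) := by
        gcongr
        exact norm_sub_sub_le_of_norm_fderiv_fderiv_le (ψ.smooth 2) hD2
    _ = C * ‖h‖ ^ 2 := by
        rw [norm_neg]
        field_simp

theorem isBigO_seminorm_compSubConstCLM_sub_add (k n : ℕ) (ψ : 𝓢(E, F)) :
    (fun h : E => SchwartzMap.seminorm ℝ k n
      (SchwartzMap.compSubConstCLM ℝ h ψ - ψ + ∂_{h} ψ)) =O[𝓝 0] fun h => ‖h‖ ^ 2 := by
  induction n generalizing F with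
  | zero => exact isBigO_seminorm_zero_compSubConstCLM_sub_add k ψ
  | succ n ih =>
    refine .trans (.of_norm_le fun h => ?_) (ih (SchwartzMap.fderivCLM ℝ E F ψ))
    rw [Real.norm_of_nonneg (apply_nonneg _ _), ← fderivCLM_compSubConstCLM_sub_add_lineDerivOp]
    refine SchwartzMap.seminorm_le_bound ℝ k (n + 1) _ (apply_nonneg _ _) fun x => ?_
    rw [← norm_iteratedFDeriv_fderiv]
    exact SchwartzMap.le_seminorm ℝ k n (SchwartzMap.fderivCLM ℝ E F _) x

end Translation

section Convolution

variable {E F G : Type*} [NormedAddCommGroup E] [NormedSpace ℝ E]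
  [NormedAddCommGroup F] [NormedSpace ℝ F] [NormedAddCommGroup G] [NormedSpace ℝ G]

/-- The convolution `x ↦ ⟨g, φ(x - ·)⟩` of a tempered distribution with a Schwartz function. -/
def conv (g : 𝓢(E, F) →L[ℝ] G) (φ : 𝓢(E, F)) (x : E) : G :=
  g (SchwartzMap.compSubConstCLM ℝ x (dilation (-1) (neg_ne_zero.mpr one_ne_zero) φ))

theorem conv_eq {g : 𝓢(E, F) →L[ℝ] G} {φ ψ : 𝓢(E, F)} {x : E} (h : ∀ y, ψ y = φ (x - y)) :
    conv g φ x = g ψ := by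
  unfold conv
  congr 1
  ext y
  simp [SchwartzMap.compSubConstCLM_apply, h]

theorem lineDerivOp_dilation (c : ℝ) (hc : c ≠ 0) (h : E) (ψ : 𝓢(E, F)) :
    ∂_{h} (dilation c hc ψ) = c • dilation c hc (∂_{h} ψ) := by
  have hh : (ContinuousLinearEquiv.smulLeft (Units.mk0 c hc) : E ≃L[ℝ] E) h = c • h := rfl
  unfold dilation
  rw [SchwartzMap.lineDerivOp_compCLMOfContinuousLinearEquiv, hh,
    LineDeriv.lineDerivOp_left_smul, map_smul]

end Convolution

section ConvolutionDerivatives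

variable {E F : Type u} {G : Type*} [NormedAddCommGroup E] [NormedSpace ℝ E]
  [FiniteDimensional ℝ E] [NormedAddCommGroup F] [NormedSpace ℝ F] [NormedAddCommGroup G]
  [NormedSpace ℝ G]

/-- The derivative `h ↦ (g * ∂_h φ)(x)` of `g * φ` at `x`. -/
def convDeriv (g : 𝓢(E, F) →L[ℝ] G) (φ : 𝓢(E, F)) (x : E) : E →L[ℝ] G :=
  LinearMap.toContinuousLinearMap
    { toFun := fun h => conv g (∂_{h} φ) x
      map_add' := fun h k => by simp only [conv, LineDeriv.lineDerivOp_left_add, map_add]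
      map_smul' := fun c h => by
        simp only [conv, LineDeriv.lineDerivOp_left_smul, map_smul, RingHom.id_apply] }

@[simp]
theorem convDeriv_apply (g : 𝓢(E, F) →L[ℝ] G) (φ : 𝓢(E, F)) (x h : E) :
    convDeriv g φ x h = conv g (∂_{h} φ) x := rfl

theorem hasFDerivAt_conv (g : 𝓢(E, F) →L[ℝ] G) (φ : 𝓢(E, F)) (x : E) :
    HasFDerivAt (conv g φ) (convDeriv g φ x) x := by
  let ψ := SchwartzMap.compSubConstCLM ℝ x (dilation (-1) (neg_ne_zero.mpr one_ne_zero) φ)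
  have hrem (h : E) : conv g φ (x + h) - conv g φ x - convDeriv g φ x h =
      g (SchwartzMap.compSubConstCLM ℝ h ψ - ψ + ∂_{h} ψ) := by
    have htrans : conv g φ (x + h) = g (SchwartzMap.compSubConstCLM ℝ h ψ) :=
      conv_eq fun y => by simp [ψ, SchwartzMap.compSubConstCLM_apply]
    have hderiv : convDeriv g φ x h = -g (∂_{h} ψ) := by
      simp only [convDeriv_apply, conv, ψ, lineDerivOp_compSubConstCLM, lineDerivOp_dilation,
        neg_smul, one_smul, map_neg, neg_neg]
    rw [htrans, hderiv, map_add, map_sub, sub_neg_eq_add]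
    rfl
  obtain ⟨s, C, -, hC⟩ := Seminorm.bound_of_continuous (schwartz_withSeminorms ℝ E F)
    ((normSeminorm ℝ G).comp g.toLinearMap) (continuous_norm.comp g.continuous)
  have hO : (fun h => conv g φ (x + h) - conv g φ x - convDeriv g φ x h) =O[𝓝 0]
      fun h : E => ‖h‖ ^ 2 := by
    have hsum : (fun h : E => ∑ m ∈ s, SchwartzMap.seminorm ℝ m.1 m.2
        (SchwartzMap.compSubConstCLM ℝ h ψ - ψ + ∂_{h} ψ)) =O[𝓝 0] fun h => ‖h‖ ^ 2 :=
      .fun_sum fun m _ => isBigO_seminorm_compSubConstCLM_sub_add m.1 m.2 ψ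
    refine .trans (.of_norm_le fun h => ?_) (hsum.const_mul_left C)
    rw [hrem]
    refine (hC _).trans ?_
    refine mul_le_mul_of_nonneg_left (Seminorm.finset_sup_apply_le (by positivity) ?_) C.2
    intro m hm
    exact Finset.single_le_sum (f := fun m : ℕ × ℕ => SchwartzMap.seminorm ℝ m.1 m.2
      (SchwartzMap.compSubConstCLM ℝ h ψ - ψ + ∂_{h} ψ)) (fun _ _ => by positivity) hm
  rw [hasFDerivAt_iff_isLittleO_nhds_zero]
  exact hO.trans_isLittleO (Asymptotics.isLittleO_norm_pow_id one_lt_two)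

theorem fderiv_conv (g : 𝓢(E, F) →L[ℝ] G) (φ : 𝓢(E, F)) :
    fderiv ℝ (conv g φ) = convDeriv g φ :=
  funext fun x => (hasFDerivAt_conv g φ x).fderiv

theorem contDiff_conv (n : ℕ) (g : 𝓢(E, F) →L[ℝ] G) (φ : 𝓢(E, F)) : ContDiff ℝ n (conv g φ) := by
  have hdiff (φ : 𝓢(E, F)) : Differentiable ℝ (conv g φ) := fun x =>
    (hasFDerivAt_conv g φ x).differentiableAt
  induction n generalizing φ with
  | zero => exact contDiff_zero.2 (hdiff φ).continuous
  | succ n ih =>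
    push_cast
    refine contDiff_succ_iff_fderiv.2 ⟨hdiff φ, by simp, ?_⟩
    rw [fderiv_conv, contDiff_clm_apply_iff]
    exact fun h => ih (∂_{h} φ)

theorem continuous_conv (g : 𝓢(E, F) →L[ℝ] G) (φ : 𝓢(E, F)) : Continuous (conv g φ) :=
  (contDiff_conv 0 g φ).continuous

theorem fderiv_fderiv_conv_apply (g : 𝓢(E, F) →L[ℝ] G) (φ : 𝓢(E, F)) (x h k : E) :
    fderiv ℝ (fderiv ℝ (conv g φ)) x h k = conv g (∂_{h} (∂_{k} φ)) x := by
  have hd : DifferentiableAt ℝ (fderiv ℝ (conv g φ)) x :=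
    ((contDiff_conv 2 g φ).fderiv_right (m := 1) (by norm_num)).differentiable (by norm_num) x
  calc fderiv ℝ (fderiv ℝ (conv g φ)) x h k
      = fderiv ℝ (fun y => fderiv ℝ (conv g φ) y k) x h := by
        rw [fderiv_clm_apply hd (differentiableAt_const _)]
        simp
    _ = conv g (∂_{h} (∂_{k} φ)) x := by
        simp only [fderiv_conv, convDeriv_apply]

end ConvolutionDerivatives

theorem laplacian_eq_sum_fderiv_fderiv {ι E F : Type*} [Fintype ι] [NormedAddCommGroup E]
    [InnerProductSpace ℝ E] [FiniteDimensional ℝ E] [NormedAddCommGroup F] [NormedSpace ℝ F]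
    (b : OrthonormalBasis ι ℝ E) (u : E → F) (x : E) :
    Δ u x = ∑ i, fderiv ℝ (fderiv ℝ u) x (b i) (b i) := by
  simp [InnerProductSpace.laplacian_eq_iteratedFDeriv_orthonormalBasis u b,
    iteratedFDeriv_two_apply]

theorem laplacian_conv {E F : Type u} {G : Type*} [NormedAddCommGroup E] [InnerProductSpace ℝ E]
    [FiniteDimensional ℝ E] [NormedAddCommGroup F] [NormedSpace ℝ F] [NormedAddCommGroup G]
    [NormedSpace ℝ G] (g : 𝓢(E, F) →L[ℝ] G) (φ : 𝓢(E, F)) (x : E) :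
    Δ (conv g φ) x = conv g (Δ φ) x := by
  rw [laplacian_eq_sum_fderiv_fderiv (stdOrthonormalBasis ℝ E),
    SchwartzMap.laplacian_eq_sum (stdOrthonormalBasis ℝ E)]
  simp only [fderiv_fderiv_conv_apply, conv, map_sum]

/-! ### The mean value inequality -/

section MeanValue

variable {E : Type*} [NormedAddCommGroup E]

/-- The bump `(1 - |y|²)₊`, the weight of the mean values below. It is chosen because the gradient
of its square is `-4 (1 - |y|²)₊ y`, a multiple of the radial field. -/
def paraboloid (y : E) : ℝ := max 0 (1 - ‖y‖ ^ 2)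

theorem continuous_paraboloid : Continuous (paraboloid : E → ℝ) := by
  unfold paraboloid; fun_prop

theorem paraboloid_nonneg (y : E) : 0 ≤ paraboloid y := le_max_left _ _

theorem paraboloid_le_one (y : E) : paraboloid y ≤ 1 :=
  max_le zero_le_one (by linarith [sq_nonneg ‖y‖])

theorem paraboloid_eq_zero_of_notMem {y : E} (hy : y ∉ Metric.closedBall (0 : E) 1) :
    paraboloid y = 0 := by
  have : 1 < ‖y‖ := by simpa using hy
  exact max_eq_left (by nlinarith)

theorem hasCompactSupport_paraboloid [ProperSpace E] :
    HasCompactSupport (paraboloid : E → ℝ) :=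
  .intro (isCompact_closedBall 0 1) fun _ => paraboloid_eq_zero_of_notMem

theorem hasCompactSupport_paraboloid_sq [ProperSpace E] :
    HasCompactSupport fun y : E => paraboloid y ^ 2 :=
  hasCompactSupport_paraboloid.comp_left (g := (· ^ 2)) (zero_pow two_ne_zero)

theorem hasDerivAt_max_zero_sq (s : ℝ) :
    HasDerivAt (fun s : ℝ => max 0 s ^ 2) (2 * max 0 s) s := by
  rcases lt_trichotomy s 0 with hs | rfl | hs
  · have h : (fun s : ℝ => max 0 s ^ 2) =ᶠ[𝓝 s] fun _ => 0 := by
      filter_upwards [gt_mem_nhds hs] with y hy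
      rw [max_eq_left hy.le, zero_pow two_ne_zero]
    rw [max_eq_left hs.le, mul_zero]
    exact (hasDerivAt_const s (0 : ℝ)).congr_of_eventuallyEq h
  · rw [max_self, mul_zero, hasDerivAt_iff_isLittleO_nhds_zero]
    refine Asymptotics.IsBigO.trans_isLittleO (g := fun h : ℝ => ‖h‖ ^ 2) ?_
      (Asymptotics.isLittleO_norm_pow_id one_lt_two)
    refine .of_bound 1 (.of_forall fun h => ?_)
    have h1 : |max 0 h| ≤ |h| := by
      rw [abs_of_nonneg (le_max_left 0 h)]
      exact max_le (abs_nonneg h) (le_abs_self h)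
    simpa using pow_le_pow_left₀ (abs_nonneg _) h1 2
  · have h : (fun s : ℝ => max 0 s ^ 2) =ᶠ[𝓝 s] fun s => s ^ 2 := by
      filter_upwards [lt_mem_nhds hs] with y hy
      rw [max_eq_right hy.le]
    rw [max_eq_right hs.le]
    simpa using (hasDerivAt_pow 2 s).congr_of_eventuallyEq h

variable [InnerProductSpace ℝ E]

theorem hasFDerivAt_paraboloid_sq (y : E) :
    HasFDerivAt (fun y : E => paraboloid y ^ 2) (-(4 * paraboloid y) • innerSL ℝ y) y := by
  have h : HasFDerivAt (fun y : E => 1 - ‖y‖ ^ 2) (-(2 • innerSL ℝ y)) y :=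
    (hasStrictFDerivAt_norm_sq y).hasFDerivAt.const_sub 1
  refine ((hasDerivAt_max_zero_sq (1 - ‖y‖ ^ 2)).comp_hasFDerivAt y h).congr_fderiv ?_
  ext z
  simp only [smul_apply, neg_apply, smul_eq_mul, nsmul_eq_mul, paraboloid]
  push_cast
  ring

theorem hasFDerivAt_comp_add_smul {E F : Type*} [NormedAddCommGroup E]
    [NormedSpace ℝ E] [NormedAddCommGroup F] [NormedSpace ℝ F] {f : E → F}
    (hf : Differentiable ℝ f) (x : E) (ρ : ℝ) (y : E) :
    HasFDerivAt (fun y => f (x + ρ • y)) (ρ • fderiv ℝ f (x + ρ • y)) y := by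
  have h := (hf (x + ρ • y)).hasFDerivAt.comp y (((hasFDerivAt_id y).const_smul ρ).const_add x)
  rwa [ContinuousLinearMap.comp_smul, ContinuousLinearMap.comp_id] at h

variable [FiniteDimensional ℝ E] [MeasurableSpace E] [BorelSpace E]

theorem integral_paraboloid_pos : 0 < ∫ y : E, paraboloid y :=
  continuous_paraboloid.integral_pos_of_hasCompactSupport_nonneg_nonzero
    hasCompactSupport_paraboloid paraboloid_nonneg (x := 0) (by simp [paraboloid])

variable {u : E → ℝ}

theorem integral_fderiv_mul_inner_mul_paraboloid (hu : ContDiff ℝ 2 u) (x e : E) (ρ : ℝ) :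
    ∫ y, fderiv ℝ u (x + ρ • y) e * (4 * (inner ℝ y e * paraboloid y)) =
      ρ * ∫ y, fderiv ℝ (fderiv ℝ u) (x + ρ • y) e e * paraboloid y ^ 2 := by
  have hu' : ContDiff ℝ 1 (fderiv ℝ u) := hu.fderiv_right le_rfl
  have hc' : Continuous (fderiv ℝ u) := hu'.continuous
  have hp := continuous_paraboloid (E := E)
  have hcs := hasCompactSupport_paraboloid (E := E)
  have hcs2 := hasCompactSupport_paraboloid_sq (E := E)
  have hsnd : ∀ y, HasLineDerivAt ℝ (fun y => fderiv ℝ u (x + ρ • y) e)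
      (ρ * fderiv ℝ (fderiv ℝ u) (x + ρ • y) e e) y e := fun y => by
    have h := hasFDerivAt_comp_add_smul (hu'.differentiable one_ne_zero) x ρ y
    exact ((ContinuousLinearMap.apply ℝ ℝ e).hasFDerivAt.comp y h).hasLineDerivAt e
  have hker : ∀ y, HasLineDerivAt ℝ (fun y : E => paraboloid y ^ 2)
      (-(4 * (inner ℝ y e * paraboloid y))) y e := fun y => by
    convert (hasFDerivAt_paraboloid_sq y).hasLineDerivAt e using 1
    simp only [smul_apply, innerSL_apply_apply, smul_eq_mul]
    ring
  have ibp := integral_bilinear_hasLineDerivAt_right_eq_neg_left_of_integrable (μ := volume)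
    (B := ContinuousLinearMap.mul ℝ ℝ)
    (Continuous.integrable_of_hasCompactSupport (by fun_prop) hcs2.mul_left)
    (Continuous.integrable_of_hasCompactSupport (by fun_prop)
      hcs.mul_left.mul_left.neg.mul_left)
    (Continuous.integrable_of_hasCompactSupport (by fun_prop) hcs2.mul_left)
    (fun y _ => hsnd y) (fun y _ => hker y)
  simp only [ContinuousLinearMap.mul_apply', mul_assoc ρ, integral_const_mul] at ibp
  rw [← neg_inj, ← ibp, ← integral_neg]
  exact integral_congr_ae (ae_of_all _ fun y => (mul_neg _ _).symm)

/-- The divergence theorem on the ball: by the choice of the weight, the radial derivative of the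
mean value is controlled by the Laplacian. -/
theorem integral_fderiv_mul_paraboloid_eq (hu : ContDiff ℝ 2 u) (x : E) (ρ : ℝ) :
    ∫ y, fderiv ℝ u (x + ρ • y) y * paraboloid y =
      ρ / 4 * ∫ y, Δ u (x + ρ • y) * paraboloid y ^ 2 := by
  have hu' : ContDiff ℝ 1 (fderiv ℝ u) := hu.fderiv_right le_rfl
  have hc' : Continuous (fderiv ℝ u) := hu'.continuous
  have hp := continuous_paraboloid (E := E)
  have hcs := hasCompactSupport_paraboloid (E := E)
  let b := stdOrthonormalBasis ℝ E
  have hradial : ∀ y, fderiv ℝ u (x + ρ • y) y * paraboloid y =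
      4⁻¹ * ∑ i, fderiv ℝ u (x + ρ • y) (b i) * (4 * (inner ℝ y (b i) * paraboloid y)) :=
    fun y => by
      conv_lhs => rw [← b.sum_repr' y]
      simp only [map_sum, map_smul, smul_eq_mul, Finset.sum_mul, Finset.mul_sum]
      conv_lhs => rw [b.sum_repr' y]
      exact Finset.sum_congr rfl fun i _ => by rw [real_inner_comm]; ring
  have hlap : ∀ y, Δ u (x + ρ • y) * paraboloid y ^ 2 =
      ∑ i, fderiv ℝ (fderiv ℝ u) (x + ρ • y) (b i) (b i) * paraboloid y ^ 2 := fun y => by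
    rw [laplacian_eq_sum_fderiv_fderiv b, Finset.sum_mul]
  simp only [hradial, hlap, integral_const_mul]
  rw [integral_finsetSum, integral_finsetSum, Finset.mul_sum, Finset.mul_sum]
  · exact Finset.sum_congr rfl fun i _ => by
      rw [integral_fderiv_mul_inner_mul_paraboloid hu]; ring
  · exact fun i _ => Continuous.integrable_of_hasCompactSupport (by fun_prop)
      hasCompactSupport_paraboloid_sq.mul_left
  · exact fun i _ => Continuous.integrable_of_hasCompactSupport (by fun_prop)
      hcs.mul_left.mul_left.mul_left

theorem hasDerivAt_integral_mul_paraboloid (hu : ContDiff ℝ 1 u) (x : E) (ρ : ℝ) :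
    HasDerivAt (fun ρ : ℝ => ∫ y, u (x + ρ • y) * paraboloid y)
      (∫ y, fderiv ℝ u (x + ρ • y) y * paraboloid y) ρ := by
  have hc : Continuous u := hu.continuous
  have hp := continuous_paraboloid (E := E)
  have hcs := hasCompactSupport_paraboloid (E := E)
  have hF : ∀ σ : ℝ, Continuous fun y => u (x + σ • y) * paraboloid y := fun σ => by fun_prop
  have hF' : Continuous fun z : ℝ × E => fderiv ℝ u (x + z.1 • z.2) z.2 * paraboloid z.2 := by
    fun_prop
  obtain ⟨C, hC⟩ := ((isCompact_closedBall ρ 1).prod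
    (isCompact_closedBall (0 : E) 1)).exists_bound_of_continuousOn hF'.continuousOn
  refine (hasDerivAt_integral_of_dominated_loc_of_deriv_le
    (F' := fun ρ y => fderiv ℝ u (x + ρ • y) y * paraboloid y)
    (bound := (Metric.closedBall (0 : E) 1).indicator fun _ => C)
    (Metric.ball_mem_nhds ρ one_pos)
    (.of_forall fun σ => (hF σ).aestronglyMeasurable)
    ((hF ρ).integrable_of_hasCompactSupport hcs.mul_left)
    (hF'.comp (by fun_prop : Continuous fun y : E => (ρ, y))).aestronglyMeasurable
    (ae_of_all _ fun y σ hσ => ?_) ?_ (ae_of_all _ fun y σ _ => ?_)).2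
  · by_cases hy : y ∈ Metric.closedBall (0 : E) 1
    · rw [indicator_of_mem hy]
      exact hC (σ, y) ⟨Metric.ball_subset_closedBall hσ, hy⟩
    · rw [indicator_of_notMem hy, paraboloid_eq_zero_of_notMem hy, mul_zero, norm_zero]
  · exact (integrable_indicator_iff measurableSet_closedBall).2
      (integrableOn_const (isCompact_closedBall (0 : E) 1).measure_lt_top.ne)
  · have hray : HasDerivAt (fun σ : ℝ => x + σ • y) y σ := by
      simpa using ((hasDerivAt_id σ).smul_const y).const_add x
    exact ((hu.differentiable one_ne_zero _).hasFDerivAt.comp_hasDerivAt σ hray).mul_const _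

theorem abs_integral_mul_paraboloid_sub_le (hu : ContDiff ℝ 2 u) {K : ℝ} (hK : ∀ x, |Δ u x| ≤ K)
    (x : E) {r : ℝ} (hr : 0 ≤ r) :
    |(∫ y, u (x + r • y) * paraboloid y) - u x * ∫ y : E, paraboloid y| ≤
      r ^ 2 * K * ∫ y : E, paraboloid y ^ 2 := by
  have hderiv : ∀ ρ ∈ Ico 0 r, ‖∫ y, fderiv ℝ u (x + ρ • y) y * paraboloid y‖ ≤
      r * (K * ∫ y : E, paraboloid y ^ 2) := fun ρ hρ => by
    rw [integral_fderiv_mul_paraboloid_eq hu, norm_mul, ← integral_const_mul]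
    refine mul_le_mul ?_ ?_ (norm_nonneg _) hr
    · rw [Real.norm_of_nonneg (by linarith [hρ.1])]
      linarith [hρ.1, hρ.2]
    · refine norm_integral_le_of_norm_le ((Continuous.integrable_of_hasCompactSupport
        (continuous_paraboloid.pow 2)
        hasCompactSupport_paraboloid_sq).const_mul K) (ae_of_all _ fun y => ?_)
      rw [norm_mul, Real.norm_of_nonneg (sq_nonneg (paraboloid y))]
      exact mul_le_mul_of_nonneg_right (hK _) (sq_nonneg _)
  have h := norm_image_sub_le_of_norm_deriv_le_segment'
    (fun ρ _ => (hasDerivAt_integral_mul_paraboloid (hu.of_le one_le_two) x ρ).hasDerivWithinAt)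
    hderiv r (right_mem_Icc.2 hr)
  simp only [zero_smul, add_zero, sub_zero, integral_const_mul, Real.norm_eq_abs] at h
  exact h.trans_eq (by ring)

theorem abs_integral_mul_paraboloid_le (hu : Continuous u) :
    |∫ y, u y * paraboloid y| ≤ ∫ y in Metric.closedBall (0 : E) 1, |u y| := by
  rw [← setIntegral_eq_integral_of_forall_compl_eq_zero (s := Metric.closedBall (0 : E) 1)
    fun y hy => by rw [paraboloid_eq_zero_of_notMem hy, mul_zero]]
  have hint : IntegrableOn (fun y => |u y|) (Metric.closedBall (0 : E) 1) :=
    hu.abs.continuousOn.integrableOn_compact (isCompact_closedBall _ _)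
  rw [← Real.norm_eq_abs]
  refine norm_integral_le_of_norm_le hint (ae_of_all _ fun y => ?_)
  rw [norm_mul, Real.norm_of_nonneg (paraboloid_nonneg y)]
  exact mul_le_of_le_one_right (norm_nonneg _) (paraboloid_le_one y)

variable (E) in
theorem exists_abs_le_integral_closedBall_add : ∃ C : ℝ, 0 < C ∧ ∀ u : E → ℝ, ContDiff ℝ 2 u →
    ∀ K : ℝ, (∀ x, |Δ u x| ≤ K) → ∀ (x : E) (r : ℝ), 0 ≤ r →
      |u x| ≤ C * ((∫ y in Metric.closedBall (0 : E) 1, |u (x + r • y)|) + r ^ 2 * K) := by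
  have hI : 0 < ∫ y : E, paraboloid y := integral_paraboloid_pos
  have hJ : 0 ≤ ∫ y : E, paraboloid y ^ 2 := integral_nonneg fun _ => sq_nonneg _
  refine ⟨(1 + ∫ y : E, paraboloid y ^ 2) / ∫ y : E, paraboloid y, by positivity,
    fun u hu K hK x r hr => ?_⟩
  have hK0 : 0 ≤ K := (abs_nonneg _).trans (hK x)
  have hc := hu.continuous
  have hmean := abs_integral_mul_paraboloid_le (by fun_prop : Continuous fun y => u (x + r • y))
  have hdiff := abs_integral_mul_paraboloid_sub_le hu hK x hr
  have hx : |u x| * ∫ y : E, paraboloid y ≤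
      (∫ y in Metric.closedBall (0 : E) 1, |u (x + r • y)|) +
        r ^ 2 * K * ∫ y : E, paraboloid y ^ 2 := by
    rw [abs_sub_comm] at hdiff
    have habs := abs_mul (u x) (∫ y : E, paraboloid y)
    rw [abs_of_pos hI] at habs
    linarith [abs_sub_abs_le_abs_sub (u x * ∫ y : E, paraboloid y)
      (∫ y, u (x + r • y) * paraboloid y)]
  have hS : 0 ≤ ∫ y in Metric.closedBall (0 : E) 1, |u (x + r • y)| :=
    integral_nonneg fun _ => abs_nonneg _
  rw [div_mul_eq_mul_div, le_div_iff₀ hI]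
  nlinarith [mul_nonneg hJ hS, mul_nonneg (sq_nonneg r) hK0]

end MeanValue

/-! ### From integral bounds with small exponents to uniform bounds -/

section HardyLittlewood

theorem le_rpow_mul_rpow {z L q : ℝ} (hz : 0 ≤ z) (hzL : z ≤ L) (hq : q ≤ 1) :
    z ≤ L ^ (1 - q) * z ^ q := by
  rcases hz.eq_or_lt with rfl | hz
  · positivity
  · calc z = z ^ (1 - q) * z ^ q := by rw [← Real.rpow_add hz, sub_add_cancel, Real.rpow_one]
      _ ≤ L ^ (1 - q) * z ^ q := by gcongr

theorem le_max_rpow_of_le_mul {M A H K q : ℝ} (hq0 : 0 < q) (hq1 : q ≤ 1) (hA : 0 ≤ A)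
    (hK : 0 ≤ K) (h : M ≤ A * (M ^ (1 - q) * H + K)) :
    M ≤ max 1 ((A * (H + K)) ^ (1 / q)) := by
  rcases le_or_gt M 1 with hM | hM
  · exact hM.trans (le_max_left _ _)
  refine le_trans ?_ (le_max_right _ _)
  have hM0 : 0 < M := one_pos.trans hM
  have hle : M ^ q * M ^ (1 - q) ≤ A * (H + K) * M ^ (1 - q) :=
    calc M ^ q * M ^ (1 - q) = M := by rw [← Real.rpow_add hM0]; simp
      _ ≤ A * (M ^ (1 - q) * H + K) := h
      _ ≤ A * (M ^ (1 - q) * H + M ^ (1 - q) * K) := by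
        gcongr
        exact le_mul_of_one_le_left hK (Real.one_le_rpow hM.le (by linarith))
      _ = A * (H + K) * M ^ (1 - q) := by ring
  have hMq : M ^ q ≤ A * (H + K) := le_of_mul_le_mul_right hle (by positivity)
  calc M = (M ^ q) ^ (1 / q) := by
        rw [← Real.rpow_mul hM0.le, mul_one_div_cancel hq0.ne', Real.rpow_one]
    _ ≤ (A * (H + K)) ^ (1 / q) := Real.rpow_le_rpow (by positivity) hMq (by positivity)

theorem rpow_mul_div_rpow_mul_div_rpow {r M H a q d : ℝ} (hr : 0 < r) (hM : 0 ≤ M)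
    (haq : a * q = d) :
    r ^ a * ((M / r ^ a) ^ (1 - q) * (H / r ^ d)) = M ^ (1 - q) * H := by
  have hrd : r ^ a = (r ^ a) ^ (1 - q) * r ^ d := by
    rw [← Real.rpow_mul hr.le, ← Real.rpow_add hr]
    congr 1
    linear_combination haq
  rw [Real.div_rpow hM (by positivity)]
  nth_rw 1 [hrd]
  field_simp

variable {E : Type*} [NormedAddCommGroup E] [ProperSpace E] {u : E → ℝ}

theorem integral_closedBall_abs_le_rpow_mul [MeasurableSpace E] [BorelSpace E]
    {μ : Measure E} [IsFiniteMeasureOnCompacts μ] (hu : Continuous u) {q L : ℝ} (hq0 : 0 ≤ q)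
    (hq1 : q ≤ 1) (hL : ∀ y ∈ Metric.closedBall (0 : E) 1, |u y| ≤ L) :
    ∫ y in Metric.closedBall (0 : E) 1, |u y| ∂μ ≤
      L ^ (1 - q) * ∫ y in Metric.closedBall (0 : E) 1, |u y| ^ q ∂μ := by
  rw [← integral_const_mul]
  have hc : Continuous fun y => L ^ (1 - q) * |u y| ^ q :=
    continuous_const.mul (hu.abs.rpow_const fun _ => .inr hq0)
  exact setIntegral_mono_on (hu.abs.continuousOn.integrableOn_compact (isCompact_closedBall _ _))
    (hc.continuousOn.integrableOn_compact (isCompact_closedBall _ _)) measurableSet_closedBall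
    fun y hy => le_rpow_mul_rpow (abs_nonneg _) (hL y hy) hq1

variable [NormedSpace ℝ E]

/-- The ball of radius `r` is centred at a maximum `x` of `(1 - |x - x₀|)^a |u x|` and reaches half
way to the boundary of the unit ball around `x₀`, so that the weights on it are comparable. -/
theorem exists_closedBall_rpow_mul_abs_le (hu : Continuous u) {a : ℝ} (ha : 0 < a) {x₀ : E}
    (h₀ : u x₀ ≠ 0) : ∃ (x : E) (r : ℝ), 0 < r ∧ r ≤ 1 ∧ |u x₀| ≤ (2 * r) ^ a * |u x| ∧
      ∀ y ∈ Metric.closedBall (0 : E) 1, r ^ a * |u (x + r • y)| ≤ (2 * r) ^ a * |u x| := by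
  have hc : Continuous fun x => (1 - ‖x - x₀‖) ^ a * |u x| :=
    .mul (.rpow_const (by fun_prop) fun _ => .inr ha.le) hu.abs
  obtain ⟨x, hx, hmax⟩ := (isCompact_closedBall x₀ 1).exists_isMaxOn
    ⟨x₀, Metric.mem_closedBall_self zero_le_one⟩ hc.continuousOn
  rw [mem_closedBall_iff_norm] at hx
  have hcenter : |u x₀| ≤ (1 - ‖x - x₀‖) ^ a * |u x| := by
    simpa using isMaxOn_iff.1 hmax x₀ (Metric.mem_closedBall_self zero_le_one)
  have hlt : ‖x - x₀‖ < 1 := hx.lt_of_ne fun h => by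
    rw [h, sub_self, Real.zero_rpow ha.ne', zero_mul] at hcenter
    exact h₀ (abs_nonpos_iff.1 hcenter)
  obtain ⟨r, hr⟩ : ∃ r, 2 * r = 1 - ‖x - x₀‖ := ⟨(1 - ‖x - x₀‖) / 2, by ring⟩
  have hr0 : 0 < r := by linarith
  refine ⟨x, r, hr0, by linarith [norm_nonneg (x - x₀)], hr ▸ hcenter, fun y hy => ?_⟩
  have hdist : ‖x + r • y - x₀‖ ≤ 1 - r :=
    calc ‖x + r • y - x₀‖ = ‖(x - x₀) + r • y‖ := by congr 1; abel
      _ ≤ ‖x - x₀‖ + ‖r • y‖ := norm_add_le _ _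
      _ ≤ ‖x - x₀‖ + r * 1 := by
        rw [norm_smul, Real.norm_of_nonneg hr0.le]
        gcongr
        simpa using hy
      _ = 1 - r := by linarith
  calc r ^ a * |u (x + r • y)| ≤ (1 - ‖x + r • y - x₀‖) ^ a * |u (x + r • y)| := by
        gcongr
        linarith
    _ ≤ (1 - ‖x - x₀‖) ^ a * |u x| := isMaxOn_iff.1 hmax _
        (mem_closedBall_iff_norm.2 (hdist.trans (by linarith)))
    _ = (2 * r) ^ a * |u x| := by rw [hr]

variable [MeasurableSpace E] [BorelSpace E] {μ : Measure E} [IsFiniteMeasureOnCompacts μ]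

/-- An argument of Hardy and Littlewood: at a maximum of the weighted function, all but the `q`-th
power of `|u|` in the mean value can be absorbed in the left-hand side. -/
theorem abs_le_max_of_integral_rpow_le (hu : Continuous u) {C d q H K : ℝ} (hC : 0 ≤ C)
    (hd : 0 < d) (hq0 : 0 < q) (hq1 : q ≤ 1) (hK : 0 ≤ K)
    (hmean : ∀ (x : E) (r : ℝ), 0 < r →
      |u x| ≤ C * ((∫ y in Metric.closedBall (0 : E) 1, |u (x + r • y)| ∂μ) + r ^ 2 * K))
    (hH : ∀ (x : E) (r : ℝ), 0 < r →
      ∫ y in Metric.closedBall (0 : E) 1, |u (x + r • y)| ^ q ∂μ ≤ H / r ^ d) (x₀ : E) :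
    |u x₀| ≤ max 1 ((2 ^ (d / q) * C * (H + K)) ^ (1 / q)) := by
  rcases eq_or_ne (u x₀) 0 with h₀ | h₀
  · rw [h₀, abs_zero]
    exact zero_le_one.trans (le_max_left _ _)
  have haq : d / q * q = d := div_mul_cancel₀ d hq0.ne'
  set a := d / q
  have ha : 0 < a := by positivity
  obtain ⟨x, r, hr0, hr1, hle, hball⟩ := exists_closedBall_rpow_mul_abs_le hu ha h₀
  refine hle.trans (le_max_rpow_of_le_mul hq0 hq1 (by positivity) hK ?_)
  set M := (2 * r) ^ a * |u x| with hM
  have hbound : ∀ y ∈ Metric.closedBall (0 : E) 1, |u (x + r • y)| ≤ M / r ^ a := fun y hy => by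
    rw [le_div_iff₀' (by positivity)]
    exact hball y hy
  have hint : ∫ y in Metric.closedBall (0 : E) 1, |u (x + r • y)| ∂μ ≤
      (M / r ^ a) ^ (1 - q) * (H / r ^ d) :=
    (integral_closedBall_abs_le_rpow_mul (by fun_prop) hq0.le hq1 hbound).trans
      (mul_le_mul_of_nonneg_left (hH x r hr0) (by positivity))
  have hrK : r ^ a * (r ^ 2 * K) ≤ K :=
    calc r ^ a * (r ^ 2 * K) ≤ 1 * (1 * K) := by
          gcongr
          · exact Real.rpow_le_one hr0.le hr1 ha.le
          · exact pow_le_one₀ hr0.le hr1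
      _ = K := by ring
  calc M = 2 ^ a * (r ^ a * |u x|) := by rw [hM, Real.mul_rpow zero_le_two hr0.le]; ring
    _ ≤ 2 ^ a * (r ^ a * (C * ((M / r ^ a) ^ (1 - q) * (H / r ^ d) + r ^ 2 * K))) := by
      gcongr
      exact (hmean x r hr0).trans (by gcongr)
    _ = 2 ^ a * C * (r ^ a * ((M / r ^ a) ^ (1 - q) * (H / r ^ d)) + r ^ a * (r ^ 2 * K)) := by
      ring
    _ ≤ 2 ^ a * C * (M ^ (1 - q) * H + K) := by
      rw [rpow_mul_div_rpow_mul_div_rpow hr0 (by positivity) haq]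
      gcongr

end HardyLittlewood

/-! ### The pressure equation -/

theorem locallyIntegrableOn_of_integrableOn_mul {E : Type*} [NormedAddCommGroup E]
    [NormedSpace ℝ E] [FiniteDimensional ℝ E] [MeasurableSpace E] [BorelSpace E] {μ : Measure E}
    {U : Set E} (hU : IsOpen U) {f : E → ℝ}
    (hf : ∀ ξ : E → ℝ, ContDiff ℝ (⊤ : ℕ∞) ξ → HasCompactSupport ξ → tsupport ξ ⊆ U →
      IntegrableOn (fun x => f x * ξ x) U μ) :
    LocallyIntegrableOn f U μ := by
  intro x₀ hx₀
  obtain ⟨r, hr, hball⟩ := Metric.isOpen_iff.1 hU x₀ hx₀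
  let b : ContDiffBump x₀ := ⟨r / 4, r / 2, by positivity, by linarith⟩
  have hsupp : tsupport b ⊆ U := by
    rw [b.tsupport_eq]
    exact (Metric.closedBall_subset_ball (by change r / 2 < r; linarith)).trans hball
  have hsub : Metric.ball x₀ (r / 4) ⊆ U := (Metric.ball_subset_ball (by linarith)).trans hball
  refine ⟨Metric.ball x₀ (r / 4),
    mem_nhdsWithin_of_mem_nhds (Metric.ball_mem_nhds _ (by positivity)), ?_⟩
  refine ((hf b b.contDiff b.hasCompactSupport hsupp).mono_set hsub).congr_fun (fun x hx => ?_)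
    measurableSet_ball
  change f x * b x = f x
  rw [b.one_of_mem_closedBall (Metric.ball_subset_closedBall hx), mul_one]

theorem ae_restrict_eq_zero_of_integral_mul_eq_zero {E : Type*} [NormedAddCommGroup E]
    [NormedSpace ℝ E] [FiniteDimensional ℝ E] [MeasurableSpace E] [BorelSpace E] {μ : Measure E}
    {U : Set E} (hU : IsOpen U) {f : E → ℝ}
    (hf : ∀ ξ : E → ℝ, ContDiff ℝ (⊤ : ℕ∞) ξ → HasCompactSupport ξ → tsupport ξ ⊆ U →
      IntegrableOn (fun x => f x * ξ x) U μ)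
    (hf₀ : ∀ ξ : E → ℝ, ContDiff ℝ (⊤ : ℕ∞) ξ → HasCompactSupport ξ → tsupport ξ ⊆ U →
      ∫ x in U, f x * ξ x ∂μ = 0) :
    ∀ᵐ x ∂μ.restrict U, f x = 0 := by
  rw [ae_restrict_iff' hU.measurableSet]
  refine hU.ae_eq_zero_of_integral_contDiff_smul_eq_zero
    (locallyIntegrableOn_of_integrableOn_mul hU hf) fun ξ hξ hξc hξU => ?_
  have h := hf₀ ξ hξ hξc hξU
  rw [setIntegral_eq_integral_of_forall_compl_eq_zero fun x hx => by
    rw [image_eq_zero_of_notMem_tsupport fun h => hx (hξU h), mul_zero]] at h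
  simpa only [smul_eq_mul, mul_comm] using h

theorem ae_memLp_of_memL1Lq {F : Type*} [NormedAddCommGroup F] {T : ℝ} {q : ℝ≥0∞}
    (hq0 : q ≠ 0) (hqt : q ≠ ∞) {f : ℝ → Space N → F} (hf : MemL1Lq T q f) :
    ∀ᵐ t ∂(timeMeasure T), MemLp (f t) q volume := by
  have : SFinite (timeMeasure T) := by unfold timeMeasure; infer_instance
  obtain ⟨hmeas, hint⟩ := hf
  have hnorm : AEMeasurable (fun t => eLpNorm (f t) q volume) (timeMeasure T) := by
    simp only [eLpNorm_eq_lintegral_rpow_enorm_toReal hq0 hqt]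
    exact (hmeas.enorm.pow_const q.toReal).lintegral_prod_right'.pow_const _
  filter_upwards [hmeas.prodMk_left, ae_lt_top' hnorm hint.ne] with t using And.intro

theorem integrable_mul_components {u : Space N → Space N} (hu : MemLp u 2 volume) (i j : Fin N) :
    Integrable fun x => u x i * u x j :=
  have hcomp (k : Fin N) : MemLp (fun x => u x k) 2 volume :=
    hu.continuousLinearMap_comp (EuclideanSpace.proj k : Space N →L[ℝ] ℝ)
  (hcomp i).integrable_mul (hcomp j)

section Pairing

variable {E : Type*} [NormedAddCommGroup E] [NormedSpace ℝ E] [MeasurableSpace E]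
  [BorelSpace E] {μ : Measure E} {w : E → ℝ}

theorem integrable_mul_schwartz (hw : Integrable w μ) (ψ : 𝓢(E, ℝ)) :
    Integrable (fun x => w x * ψ x) μ :=
  hw.mul_bdd (c := SchwartzMap.seminorm ℝ 0 0 ψ) ψ.continuous.aestronglyMeasurable
    (ae_of_all _ (SchwartzMap.norm_le_seminorm ℝ ψ))

theorem continuous_integral_mul_schwartz (hw : Integrable w μ) :
    Continuous fun ψ : 𝓢(E, ℝ) => ∫ x, w x * ψ x ∂μ := by
  let L : 𝓢(E, ℝ) →L[ℝ] ℝ := SchwartzMap.mkCLMtoNormedSpace (σ := RingHom.id ℝ)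
    (fun ψ => ∫ x, w x * ψ x ∂μ)
    (fun f g => by
      simp only [add_apply, mul_add]
      exact integral_add (integrable_mul_schwartz hw f) (integrable_mul_schwartz hw g))
    (fun a f => by
      simp only [smul_apply, smul_eq_mul, RingHom.id_apply, mul_left_comm _ a, integral_const_mul])
    ⟨{(0, 0)}, ∫ x, ‖w x‖ ∂μ, by positivity, fun f => by
      rw [← integral_mul_const]
      refine norm_integral_le_of_norm_le (hw.norm.mul_const _) (ae_of_all _ fun x => ?_)
      rw [norm_mul]
      gcongr
      simpa using SchwartzMap.norm_le_seminorm ℝ f x⟩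
  exact L.continuous

end Pairing

theorem continuous_pd (i : Fin N) : Continuous (pd i : 𝓢(Space N, ℝ) → 𝓢(Space N, ℝ)) :=
  (LineDeriv.lineDerivOpCLM ℝ 𝓢(Space N, ℝ) (EuclideanSpace.single i (1 : ℝ))).continuous

theorem lap_eq_laplacian (ψ : 𝓢(Space N, ℝ)) : lap ψ = Δ ψ := by
  rw [SchwartzMap.laplacian_eq_sum (EuclideanSpace.basisFun (Fin N) ℝ)]
  simp only [EuclideanSpace.basisFun_apply]
  rfl

theorem continuous_lap : Continuous (lap : 𝓢(Space N, ℝ) → 𝓢(Space N, ℝ)) :=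
  continuous_finsetSum _ fun i _ => (continuous_pd i).comp (continuous_pd i)

theorem pd_comm (i j : Fin N) (ψ : 𝓢(Space N, ℝ)) : pd i (pd j ψ) = pd j (pd i ψ) :=
  lineDerivOp_lineDerivOp_comm _ _ ψ

theorem lap_pd (j : Fin N) (ψ : 𝓢(Space N, ℝ)) : lap (pd j ψ) = pd j (lap ψ) := by
  have hsum : pd j (lap ψ) = ∑ i, pd j (pd i (pd i ψ)) := LineDeriv.lineDerivOp_sum _ _ _
  rw [hsum]
  exact Finset.sum_congr rfl fun i _ => by rw [pd_comm i j ψ, pd_comm i j]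

theorem hasCompactSupport_pd {ψ : 𝓢(Space N, ℝ)} (h : HasCompactSupport ψ) (i : Fin N) :
    HasCompactSupport (pd i ψ) :=
  h.of_isClosed_subset (isClosed_tsupport _) (SchwartzMap.tsupport_lineDerivOp_subset _ _)

theorem hasCompactSupport_lap {ψ : 𝓢(Space N, ℝ)} (h : HasCompactSupport ψ) :
    HasCompactSupport (lap ψ) :=
  Finset.sum_induction _ (fun f : 𝓢(Space N, ℝ) => HasCompactSupport f)
    (fun _ _ hf hg => hf.add hg) .zero fun i _ => hasCompactSupport_pd (hasCompactSupport_pd h i) i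

/-- The pairing of the distribution `∑ᵢⱼ ∂_i ∂_j w_ij` with a test function. -/
def hessPairing (w : Fin N → Fin N → Space N → ℝ) (ψ : 𝓢(Space N, ℝ)) : ℝ :=
  ∑ i, ∑ j, ∫ x, w i j x * pd i (pd j ψ) x

/-- The pressure equation `∑ᵢⱼ ∂_i ∂_j w_ij = -Δ f` in the sense of tempered distributions. For
solutions of the Navier–Stokes equations, it is satisfied at almost every time by
`w_ij = v^i v^j` and the pressure `f`. -/
def SolvesPressureEquation (w : Fin N → Fin N → Space N → ℝ) (f : Tempered N) : Prop :=
  ∀ ψ : 𝓢(Space N, ℝ), hessPairing w ψ = -f (lap ψ)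

theorem continuous_hessPairing {w : Fin N → Fin N → Space N → ℝ}
    (hw : ∀ i j, Integrable (w i j)) : Continuous (hessPairing w) :=
  continuous_finsetSum _ fun i _ => continuous_finsetSum _ fun j _ =>
    (continuous_integral_mul_schwartz (hw i j)).comp ((continuous_pd i).comp (continuous_pd j))

theorem integral_sum_eq_hessPairing {w : Fin N → Fin N → Space N → ℝ}
    (hw : ∀ i j, Integrable (w i j)) (ψ : 𝓢(Space N, ℝ)) :
    ∫ x, ∑ i, ∑ j, w i j x * pd i (pd j ψ) x = hessPairing w ψ := by
  rw [integral_finsetSum _ fun i _ => integrable_finsetSum _ fun j _ =>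
    integrable_mul_schwartz (hw i j) _]
  exact Finset.sum_congr rfl fun i _ => integral_finsetSum _ fun j _ =>
    integrable_mul_schwartz (hw i j) _

namespace IsWeakSolution

variable {ν T : ℝ} {v : ℝ → Space N → Space N} {p : ℝ → Tempered N}

/-- For the gradient test field `φ = ∇ψ` the time derivative and the viscous term drop out, because
`v` is divergence free. -/
theorem integral_quadratic_add_pressure_eq_zero (hsol : IsWeakSolution ν T v p)
    {ψ : 𝓢(Space N, ℝ)} (hψ : HasCompactSupport ψ) {ξ : ℝ → ℝ} (hξ : ContDiff ℝ 1 ξ)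
    (hξc : HasCompactSupport ξ) (hξT : tsupport ξ ⊆ Ioo 0 T) :
    (∫ t, (∫ x, ∑ i, ∑ j, v t x i * v t x j * pd i (pd j ψ) x) * ξ t ∂(timeMeasure T)) +
      ∫ t, p t (lap ψ) * ξ t ∂(timeMeasure T) = 0 := by
  have hweak := hsol.weak_formulation (fun j => pd j ψ) ξ (hasCompactSupport_pd hψ) hξ hξc hξT
  have htime : ∫ t, (∫ x, ∑ j, v t x j * pd j ψ x) * deriv ξ t ∂(timeMeasure T) = 0 := by
    refine integral_eq_zero_of_ae ?_
    filter_upwards [hsol.divFree] with t ht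
    rw [ht ψ hψ, zero_mul, Pi.zero_apply]
  have hvisc : ∫ t, (∫ x, ∑ j, v t x j * lap (pd j ψ) x) * ξ t ∂(timeMeasure T) = 0 := by
    refine integral_eq_zero_of_ae ?_
    filter_upwards [hsol.divFree] with t ht
    simp only [lap_pd]
    rw [ht (lap ψ) (hasCompactSupport_lap hψ), zero_mul, Pi.zero_apply]
  have hdiv : divergence (fun j => pd j ψ) = lap ψ := rfl
  rw [htime, hvisc, hdiv] at hweak
  linarith

theorem ae_quadratic_add_pressure_eq_zero (hsol : IsWeakSolution ν T v p) {ψ : 𝓢(Space N, ℝ)}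
    (hψ : HasCompactSupport ψ) :
    ∀ᵐ t ∂(timeMeasure T),
      (∫ x, ∑ i, ∑ j, v t x i * v t x j * pd i (pd j ψ) x) + p t (lap ψ) = 0 := by
  have hquad {ξ : ℝ → ℝ} (hξ : ContDiff ℝ (⊤ : ℕ∞) ξ) (hξc : HasCompactSupport ξ)
      (hξT : tsupport ξ ⊆ Ioo 0 T) :=
    hsol.integrable_quadratic (fun j => pd j ψ) ξ (hasCompactSupport_pd hψ)
      (hξ.of_le (mod_cast le_top)) hξc hξT
  have hpress {ξ : ℝ → ℝ} (hξ : ContDiff ℝ (⊤ : ℕ∞) ξ) (hξc : HasCompactSupport ξ) :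
      Integrable (fun t => p t (lap ψ) * ξ t) (timeMeasure T) :=
    have ⟨C, hC⟩ := hξc.exists_bound_of_continuous hξ.continuous
    (hsol.pressure (lap ψ)).mul_bdd (c := C) hξ.continuous.aestronglyMeasurable (ae_of_all _ hC)
  refine ae_restrict_eq_zero_of_integral_mul_eq_zero isOpen_Ioo (fun ξ hξ hξc hξT => ?_)
    fun ξ hξ hξc hξT => ?_
  · simp only [add_mul]
    exact (hquad hξ hξc hξT).add (hpress hξ hξc)
  · simp only [add_mul]
    exact (integral_add (hquad hξ hξc hξT) (hpress hξ hξc)).trans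
      (hsol.integral_quadratic_add_pressure_eq_zero hψ (hξ.of_le (mod_cast le_top)) hξc hξT)

theorem ae_memLp (hsol : IsWeakSolution ν T v p) : ∀ᵐ t ∂(timeMeasure T), MemLp (v t) 2 volume :=
  ae_memLp_of_memL1Lq two_ne_zero ENNReal.ofNat_ne_top hsol.memL1L2

/-- A countable dense set of test functions makes the exceptional set of times independent of the
test function. -/
theorem ae_solvesPressureEquation (hsol : IsWeakSolution ν T v p) :
    ∀ᵐ t ∂(timeMeasure T), SolvesPressureEquation (fun i j x => v t x i * v t x j) (p t) := by
  obtain ⟨S, hS, hdense, hcompact⟩ :=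
    exists_countable_dense_hasCompactSupport (E := Space N) (F := ℝ)
  have hall := (ae_ball_iff hS).2 fun ψ hψ =>
    hsol.ae_quadratic_add_pressure_eq_zero (hcompact ψ hψ)
  filter_upwards [hall, hsol.ae_memLp] with t ht hv
  have hw := integrable_mul_components hv
  refine congr_fun ((continuous_hessPairing hw).ext_on hdense
    ((p t).continuous.comp continuous_lap).neg fun ψ hψ => ?_)
  have hψt := ht ψ hψ
  rw [integral_sum_eq_hessPairing hw] at hψt
  exact eq_neg_of_add_eq_zero_left hψt

end IsWeakSolution

/-! ### Integrable pressure -/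

theorem tendsto_integral_mul_comp_smul {E : Type*} [NormedAddCommGroup E] [NormedSpace ℝ E]
    [SecondCountableTopology E] [MeasurableSpace E] [BorelSpace E] {μ : Measure E} {w g : E → ℝ}
    (hw : Integrable w μ) (hg : Continuous g) {M : ℝ} (hM : ∀ x, |g x| ≤ M) :
    Tendsto (fun c : ℝ => ∫ y, w y * g (c • y) ∂μ) (𝓝 0) (𝓝 ((∫ y, w y ∂μ) * g 0)) := by
  rw [← integral_mul_const]
  refine tendsto_integral_filter_of_dominated_convergence (fun y => ‖w y‖ * M)
    (.of_forall fun c => ?_) (.of_forall fun c => ae_of_all _ fun y => ?_) (hw.norm.mul_const M)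
    (ae_of_all _ fun y => ?_)
  · have hc : Continuous fun y => g (c • y) := by fun_prop
    exact hw.aestronglyMeasurable.mul hc.aestronglyMeasurable
  · rw [norm_mul]
    gcongr
    exact hM _
  · have hc : Continuous fun c : ℝ => w y * g (c • y) := by fun_prop
    simpa using hc.tendsto 0

theorem pd_dilation (c : ℝ) (hc : c ≠ 0) (i : Fin N) (ψ : 𝓢(Space N, ℝ)) :
    pd i (dilation c hc ψ) = c • dilation c hc (pd i ψ) :=
  lineDerivOp_dilation c hc _ ψ

theorem pd_smul (c : ℝ) (i : Fin N) (ψ : 𝓢(Space N, ℝ)) : pd i (c • ψ) = c • pd i ψ :=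
  LineDeriv.lineDerivOp_smul _ _ _

theorem pd_pd_dilation (c : ℝ) (hc : c ≠ 0) (i j : Fin N) (ψ : 𝓢(Space N, ℝ)) :
    pd i (pd j (dilation c hc ψ)) = c ^ 2 • dilation c hc (pd i (pd j ψ)) := by
  rw [pd_dilation, pd_smul, pd_dilation, smul_smul, sq]

theorem lap_dilation (c : ℝ) (hc : c ≠ 0) (ψ : 𝓢(Space N, ℝ)) :
    lap (dilation c hc ψ) = c ^ 2 • dilation c hc (lap ψ) := by
  simp only [lap, pd_pd_dilation, map_sum, Finset.smul_sum]

namespace SolvesPressureEquation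

variable {w : Fin N → Fin N → Space N → ℝ} {f : Tempered N}

theorem sum_integral_comp_smul (h : SolvesPressureEquation w f) {c : ℝ} (hc : c ≠ 0)
    (ψ : 𝓢(Space N, ℝ)) :
    ∑ i, ∑ j, ∫ y, w i j y * pd i (pd j ψ) (c • y) = -f (dilation c hc (lap ψ)) := by
  refine mul_left_cancel₀ (pow_ne_zero 2 hc) ?_
  calc c ^ 2 * ∑ i, ∑ j, ∫ y, w i j y * pd i (pd j ψ) (c • y)
      = hessPairing w (dilation c hc ψ) := by
        simp only [hessPairing, pd_pd_dilation, smul_apply, dilation_apply, smul_eq_mul,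
          mul_left_comm _ (c ^ 2), integral_const_mul, Finset.mul_sum]
    _ = c ^ 2 * -f (dilation c hc (lap ψ)) := by
        rw [h, lap_dilation, map_smul, smul_eq_mul, mul_neg]

/-- Dilating the test function until only its second derivatives at the origin are seen. -/
theorem sum_integral_mul_pd_pd_zero (h : SolvesPressureEquation w f)
    (hw : ∀ i j, Integrable (w i j)) {P : Space N → ℝ} (hP : Integrable P)
    (hfP : ∀ ψ, f ψ = ∫ x, P x * ψ x) (ψ : 𝓢(Space N, ℝ)) :
    ∑ i, ∑ j, (∫ x, w i j x) * pd i (pd j ψ) 0 = -((∫ x, P x) * lap ψ 0) := by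
  have htendsto {u : Space N → ℝ} (hu : Integrable u) (θ : 𝓢(Space N, ℝ)) :
      Tendsto (fun c : ℝ => ∫ y, u y * θ (c • y)) (𝓝[≠] 0) (𝓝 ((∫ y, u y) * θ 0)) :=
    (tendsto_integral_mul_comp_smul hu θ.continuous
      (SchwartzMap.norm_le_seminorm ℝ θ)).mono_left nhdsWithin_le_nhds
  refine tendsto_nhds_unique (tendsto_finsetSum _ fun i _ => tendsto_finsetSum _ fun j _ =>
    htendsto (hw i j) (pd i (pd j ψ))) ((htendsto hP (lap ψ)).neg.congr' ?_)
  filter_upwards [self_mem_nhdsWithin] with c hc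
  rw [h.sum_integral_comp_smul hc, hfP]
  rfl

end SolvesPressureEquation

/-- A Schwartz function which coincides with the quadratic form `x ↦ B x x` on the unit ball. -/
def quadTest {E : Type*} [NormedAddCommGroup E] [NormedSpace ℝ E] [FiniteDimensional ℝ E]
    (B : E →L[ℝ] E →L[ℝ] ℝ) : 𝓢(E, ℝ) :=
  (show HasCompactSupport fun x => bump E x * B x x from
    hasCompactSupport_bump.mul_right).toSchwartzMap (((bump E).smooth ⊤).mul (by fun_prop))

theorem fderiv_fderiv_quadTest_zero {E : Type*} [NormedAddCommGroup E] [NormedSpace ℝ E]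
    [FiniteDimensional ℝ E] (B : E →L[ℝ] E →L[ℝ] ℝ) (h k : E) :
    fderiv ℝ (fderiv ℝ (quadTest B)) 0 h k = B h k + B k h := by
  have hloc : quadTest B =ᶠ[𝓝 0] fun x => B x x := by
    filter_upwards [Metric.closedBall_mem_nhds (0 : E) one_pos] with x hx
    change bump E x * B x x = B x x
    rw [bump_eq_one (by simpa using hx), one_mul]
  have hquad : fderiv ℝ (fun x => B x x) = (B + B.flip : E →L[ℝ] E →L[ℝ] ℝ) := by
    ext x k
    rw [fderiv_clm_apply B.differentiableAt differentiableAt_fun_id]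
    simp
  rw [hloc.fderiv.fderiv_eq, hquad, ContinuousLinearMap.fderiv]
  rfl

theorem pd_pd_quadTest_zero (B : Space N →L[ℝ] Space N →L[ℝ] ℝ) (i j : Fin N) :
    pd i (pd j (quadTest B)) 0 =
      B (EuclideanSpace.single i 1) (EuclideanSpace.single j 1) +
        B (EuclideanSpace.single j 1) (EuclideanSpace.single i 1) :=
  (lineDerivOp_apply_lineDerivOp _ _ _ _).trans (fderiv_fderiv_quadTest_zero B _ _)

theorem SolvesPressureEquation.integral_add_integral_eq {w : Fin N → Fin N → Space N → ℝ}
    {f : Tempered N} (h : SolvesPressureEquation w f) (hw : ∀ i j, Integrable (w i j))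
    {P : Space N → ℝ} (hP : Integrable P) (hfP : ∀ ψ, f ψ = ∫ x, P x * ψ x) (k l : Fin N) :
    (∫ x, w k l x) + ∫ x, w l k x = if k = l then -2 * ∫ x, P x else 0 := by
  let B : Space N →L[ℝ] Space N →L[ℝ] ℝ :=
    (EuclideanSpace.proj k : Space N →L[ℝ] ℝ).smulRight (EuclideanSpace.proj l : Space N →L[ℝ] ℝ)
  have hB (x y : Space N) : B x y = x k * y l := rfl
  have hlap : lap (quadTest B) 0 = if k = l then 2 else 0 := by
    suffices ((if k = l then 1 else 0) + if k = l then 1 else 0 : ℝ) = if k = l then 2 else 0 by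
      simpa [lap, sum_apply, pd_pd_quadTest_zero, hB, Finset.sum_add_distrib, eq_comm]
    split_ifs <;> norm_num
  have hsum : (∫ x, w k l x) + ∫ x, w l k x = -((∫ x, P x) * lap (quadTest B) 0) := by
    simpa [pd_pd_quadTest_zero, hB, mul_add, Finset.sum_add_distrib] using
      h.sum_integral_mul_pd_pd_zero hw hP hfP (quadTest B)
  rw [hsum, hlap]
  split_ifs <;> ring

/-! ### Pressure in a Hardy space -/

/-- The distributions `f_n = f((n + 1) ·)` up to a factor: `⟨f_n, ψ⟩ = ⟨f, ψ(· / (n + 1))⟩`. -/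
def rescaled (f : Tempered N) (n : ℕ) : Tempered N :=
  f.comp (dilation ((n : ℝ) + 1)⁻¹ (by positivity))

/-- The constant coefficient combination `∑ᵢⱼ c_ij ∂_i ∂_j φ` of second derivatives. -/
def hessComb (c : Fin N → Fin N → ℝ) (φ : 𝓢(Space N, ℝ)) : 𝓢(Space N, ℝ) :=
  ∑ i, ∑ j, c i j • pd i (pd j φ)

theorem hessComb_apply (c : Fin N → Fin N → ℝ) (φ : 𝓢(Space N, ℝ)) (x : Space N) :
    hessComb c φ x = ∑ i, ∑ j, c i j * pd i (pd j φ) x := by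
  simp only [hessComb, sum_apply, smul_apply, smul_eq_mul]

theorem hessPairing_const_mul (c : Fin N → Fin N → ℝ) (φ ψ : 𝓢(Space N, ℝ)) :
    hessPairing (fun i j x => c i j * φ x) ψ = ∫ x, hessComb c φ x * ψ x := by
  have hparts (k : Fin N) (θ χ : 𝓢(Space N, ℝ)) : ∫ x, θ x * pd k χ x = -∫ x, pd k θ x * χ x :=
    SchwartzMap.integral_mul_lineDerivOp_right_eq_neg_left θ χ _
  have hint (i j : Fin N) : Integrable fun x => c i j * pd i (pd j φ) x * ψ x :=
    integrable_mul_schwartz ((pd i (pd j φ)).integrable.const_mul _) ψ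
  simp only [hessComb_apply, Finset.sum_mul]
  rw [integral_finsetSum _ fun i _ => integrable_finsetSum _ fun j _ => hint i j]
  refine Finset.sum_congr rfl fun i _ => ?_
  rw [integral_finsetSum _ fun j _ => hint i j]
  refine Finset.sum_congr rfl fun j _ => ?_
  simp only [mul_assoc, integral_const_mul]
  rw [hparts i φ, hparts j (pd i φ), neg_neg, pd_comm]

/-- A solution `c_ij φ` of the pressure equation without pressure is integrable, so that the case
of an integrable pressure applies to it. -/
theorem add_eq_zero_of_hessComb_eq_zero {c : Fin N → Fin N → ℝ} {φ : 𝓢(Space N, ℝ)}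
    (hφ : ∫ x, φ x ≠ 0) (h : hessComb c φ = 0) (k l : Fin N) : c k l + c l k = 0 := by
  have hsol : SolvesPressureEquation (fun i j x => c i j * φ x) 0 := fun ψ => by
    rw [hessPairing_const_mul, h]
    simp
  have hint := hsol.integral_add_integral_eq (fun i j => φ.integrable.const_mul (c i j))
    (P := fun _ => 0) (integrable_zero _ _ _) (by simp) k l
  simp only [integral_const_mul, integral_zero, mul_zero, ite_self, ← add_mul] at hint
  exact (mul_eq_zero.1 hint).resolve_right hφ

theorem integrable_conv_mul (g : Tempered N) (φ : 𝓢(Space N, ℝ)) {η : 𝓢(Space N, ℝ)}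
    (hη : HasCompactSupport η) : Integrable fun x => conv g φ x * η x :=
  ((continuous_conv g φ).mul η.continuous).integrable_of_hasCompactSupport hη.mul_left

theorem integral_conv_mul_pd (g : Tempered N) (φ : 𝓢(Space N, ℝ)) (i : Fin N)
    {η : 𝓢(Space N, ℝ)} (hη : HasCompactSupport η) :
    ∫ x, conv g φ x * pd i η x = -∫ x, conv g (pd i φ) x * η x := by
  have hderiv (x : Space N) : fderiv ℝ (conv g φ) x (EuclideanSpace.single i 1) =
      conv g (pd i φ) x := by
    rw [fderiv_conv]
    rfl
  have hpd (x : Space N) : pd i η x = fderiv ℝ η x (EuclideanSpace.single i 1) :=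
    SchwartzMap.lineDerivOp_apply_eq_fderiv _ _ _
  simp only [hpd, ← hderiv]
  refine integral_mul_fderiv_eq_neg_fderiv_mul_of_integrable ?_ ?_
    (integrable_conv_mul g φ hη)
    (fun x _ => (contDiff_conv 1 g φ).differentiable (by norm_num) x)
    fun x _ => η.differentiable x
  · simpa only [hderiv] using integrable_conv_mul g (pd i φ) hη
  · simpa only [hpd] using integrable_conv_mul g φ (hasCompactSupport_pd hη i)

theorem integral_conv_mul_lap (g : Tempered N) (φ : 𝓢(Space N, ℝ)) {η : 𝓢(Space N, ℝ)}
    (hη : HasCompactSupport η) :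
    ∫ x, conv g φ x * lap η x = ∫ x, conv g (lap φ) x * η x := by
  have hconv (x : Space N) : conv g (lap φ) x = ∑ i, conv g (pd i (pd i φ)) x := by
    simp only [conv, lap, map_sum]
  have hlap (x : Space N) : lap η x = ∑ i, pd i (pd i η) x := by
    simp only [lap, sum_apply]
  simp only [hconv, hlap, Finset.mul_sum, Finset.sum_mul]
  rw [integral_finsetSum _ fun i _ =>
      integrable_conv_mul g φ (hasCompactSupport_pd (hasCompactSupport_pd hη i) i),
    integral_finsetSum _ fun i _ => integrable_conv_mul g (pd i (pd i φ)) hη]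
  refine Finset.sum_congr rfl fun i _ => ?_
  rw [integral_conv_mul_pd g φ i (hasCompactSupport_pd hη i), integral_conv_mul_pd g (pd i φ) i hη,
    neg_neg]

theorem conv_rescaled (f : Tempered N) (φ : 𝓢(Space N, ℝ)) (n : ℕ) (x : Space N) :
    conv (rescaled f n) φ x =
      ((n : ℝ) + 1) ^ N * f (dilatedKernel φ (n + 1) (by positivity) (((n : ℝ) + 1) • x)) := by
  have hn : (n : ℝ) + 1 ≠ 0 := by positivity
  rw [← smul_eq_mul, ← map_smul, conv, rescaled, ContinuousLinearMap.comp_apply]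
  congr 1
  ext y
  simp [dilatedKernel_apply, smul_sub, hn, neg_add_eq_sub, SchwartzMap.compSubConstCLM_apply]

namespace SolvesPressureEquation

variable {w : Fin N → Fin N → Space N → ℝ} {f : Tempered N}

theorem conv_rescaled_lap (h : SolvesPressureEquation w f) (φ : 𝓢(Space N, ℝ)) (n : ℕ)
    (x : Space N) :
    conv (rescaled f n) (lap φ) x =
      -∑ i, ∑ j, ∫ y, w i j y * pd i (pd j φ) (x - ((n : ℝ) + 1)⁻¹ • y) := by
  let R : 𝓢(Space N, ℝ) →L[ℝ] 𝓢(Space N, ℝ) :=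
    (SchwartzMap.compSubConstCLM ℝ x).comp (dilation (-1) (neg_ne_zero.mpr one_ne_zero))
  have hR (θ : 𝓢(Space N, ℝ)) (y : Space N) : R θ y = θ (x - y) := by
    simp [R, SchwartzMap.compSubConstCLM_apply]
  have hpd (i j : Fin N) : pd i (pd j (R φ)) = R (pd i (pd j φ)) := by
    simp only [R, pd, ContinuousLinearMap.comp_apply, lineDerivOp_compSubConstCLM,
      lineDerivOp_dilation, neg_smul, one_smul, map_neg, LineDeriv.lineDerivOp_neg, neg_neg]
  have hlap : lap (R φ) = R (lap φ) := by
    simp only [lap, hpd, map_sum]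
  have hsum := h.sum_integral_comp_smul (c := ((n : ℝ) + 1)⁻¹) (by positivity) (R φ)
  simp only [hpd, hR, hlap] at hsum
  rw [hsum, neg_neg]
  rfl

theorem exists_abs_conv_rescaled_lap_le (h : SolvesPressureEquation w f)
    (hw : ∀ i j, Integrable (w i j)) (φ : 𝓢(Space N, ℝ)) :
    ∃ K, ∀ n x, |conv (rescaled f n) (lap φ) x| ≤ K := by
  refine ⟨∑ i, ∑ j, (∫ y, ‖w i j y‖) * SchwartzMap.seminorm ℝ 0 0 (pd i (pd j φ)), fun n x => ?_⟩
  rw [h.conv_rescaled_lap, abs_neg]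
  refine (Finset.abs_sum_le_sum_abs _ _).trans (Finset.sum_le_sum fun i _ => ?_)
  refine (Finset.abs_sum_le_sum_abs _ _).trans (Finset.sum_le_sum fun j _ => ?_)
  rw [← Real.norm_eq_abs, ← integral_mul_const]
  refine norm_integral_le_of_norm_le ((hw i j).norm.mul_const _) (ae_of_all _ fun y => ?_)
  rw [norm_mul]
  gcongr
  exact SchwartzMap.norm_le_seminorm ℝ (pd i (pd j φ)) _

theorem tendsto_conv_rescaled_lap (h : SolvesPressureEquation w f)
    (hw : ∀ i j, Integrable (w i j)) (φ : 𝓢(Space N, ℝ)) (x : Space N) :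
    Tendsto (fun n => conv (rescaled f n) (lap φ) x) atTop
      (𝓝 (-hessComb (fun i j => ∫ y, w i j y) φ x)) := by
  have hinv : Tendsto (fun n : ℕ => ((n : ℝ) + 1)⁻¹) atTop (𝓝 0) := by
    simpa only [one_div] using tendsto_one_div_add_atTop_nhds_zero_nat (𝕜 := ℝ)
  have hterm (i j : Fin N) :
      Tendsto (fun n : ℕ => ∫ y, w i j y * pd i (pd j φ) (x - ((n : ℝ) + 1)⁻¹ • y)) atTop
        (𝓝 ((∫ y, w i j y) * pd i (pd j φ) (x - 0))) :=
    (tendsto_integral_mul_comp_smul (g := fun z => pd i (pd j φ) (x - z)) (hw i j) (by fun_prop)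
      fun z => SchwartzMap.norm_le_seminorm ℝ (pd i (pd j φ)) _).comp hinv
  simp only [h.conv_rescaled_lap, hessComb_apply]
  simp only [sub_zero] at hterm
  exact (tendsto_finsetSum _ fun i _ => tendsto_finsetSum _ fun j _ => hterm i j).neg

end SolvesPressureEquation

theorem setLIntegral_comp_smul {E : Type*} [NormedAddCommGroup E] [NormedSpace ℝ E]
    [FiniteDimensional ℝ E] [MeasurableSpace E] [BorelSpace E] (μ : Measure E)
    [μ.IsAddHaarMeasure] (h : E → ℝ≥0∞) {s : ℝ} (hs : s ≠ 0) (A : Set E) :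
    ∫⁻ x in (s • ·) ⁻¹' A, h (s • x) ∂μ =
      ENNReal.ofReal |(s ^ Module.finrank ℝ E)⁻¹| * ∫⁻ x in A, h x ∂μ := by
  let e := (Homeomorph.smulOfNeZero (α := E) s hs).toMeasurableEquiv
  have hmap : μ.map e = ENNReal.ofReal |(s ^ Module.finrank ℝ E)⁻¹| • μ :=
    Measure.map_addHaar_smul μ hs
  rw [← smul_eq_mul, ← lintegral_smul_measure, ← Measure.restrict_smul, ← hmap, e.restrict_map,
    lintegral_map_equiv]
  rfl

/-- The measure with density `(𝓜_φ f)^q`, whose total mass is `‖f‖_{𝓗^q}^q`. -/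
def hardyMeasure (φ : 𝓢(Space N, ℝ)) (q : ℝ) (f : Tempered N) : Measure (Space N) :=
  volume.withDensity fun x => maximalFunction φ f x ^ q

section HardyMeasure

variable {φ : 𝓢(Space N, ℝ)} {q : ℝ} {f : Tempered N}

theorem isFiniteMeasure_hardyMeasure (hq : 0 < q) (hf : f ∈ hardySpace φ q) :
    IsFiniteMeasure (hardyMeasure φ q f) := by
  refine ⟨?_⟩
  rw [hardyMeasure, withDensity_apply _ MeasurableSet.univ, Measure.restrict_univ]
  exact (ENNReal.rpow_lt_top_iff_of_pos (one_div_pos.2 hq)).1 hf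

theorem ofReal_abs_conv_rescaled_le (f : Tempered N) (φ : 𝓢(Space N, ℝ)) (n : ℕ) (x : Space N) :
    ENNReal.ofReal |conv (rescaled f n) φ x| ≤
      ENNReal.ofReal (((n : ℝ) + 1) ^ N) * maximalFunction φ f (((n : ℝ) + 1) • x) := by
  rw [conv_rescaled, abs_mul, abs_of_pos (by positivity), ENNReal.ofReal_mul (by positivity)]
  gcongr
  exact le_iSup₂ (f := fun (s : ℝ) (hs : 0 < s) =>
    ENNReal.ofReal |f (dilatedKernel φ s hs (((n : ℝ) + 1) • x))|) _ _

theorem setLIntegral_conv_rescaled_rpow_le (φ : 𝓢(Space N, ℝ)) (hq0 : 0 < q) (hq1 : q ≤ 1)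
    (f : Tempered N) (n : ℕ) (A : Set (Space N)) :
    ∫⁻ x in (((n : ℝ) + 1) • ·) ⁻¹' A, ENNReal.ofReal (|conv (rescaled f n) φ x| ^ q) ≤
      hardyMeasure φ q f A := by
  have hs : (n : ℝ) + 1 ≠ 0 := by positivity
  have hfactor :
      ENNReal.ofReal (((n : ℝ) + 1) ^ N) ^ q * ENNReal.ofReal |(((n : ℝ) + 1) ^ N)⁻¹| ≤ 1 := by
    rw [abs_of_pos (by positivity), ENNReal.ofReal_rpow_of_nonneg (by positivity) hq0.le,
      ← ENNReal.ofReal_mul (by positivity), ENNReal.ofReal_le_one,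
      mul_inv_le_iff₀ (by positivity), one_mul]
    exact Real.rpow_le_self_of_one_le (one_le_pow₀ (by simp)) hq1
  calc ∫⁻ x in (((n : ℝ) + 1) • ·) ⁻¹' A, ENNReal.ofReal (|conv (rescaled f n) φ x| ^ q)
      ≤ ∫⁻ x in (((n : ℝ) + 1) • ·) ⁻¹' A, ENNReal.ofReal (((n : ℝ) + 1) ^ N) ^ q *
          maximalFunction φ f (((n : ℝ) + 1) • x) ^ q := by
        refine lintegral_mono fun x => ?_
        rw [← ENNReal.ofReal_rpow_of_nonneg (abs_nonneg _) hq0.le,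
          ← ENNReal.mul_rpow_of_nonneg _ _ hq0.le]
        gcongr
        exact ofReal_abs_conv_rescaled_le f φ n x
    _ = ENNReal.ofReal (((n : ℝ) + 1) ^ N) ^ q * ENNReal.ofReal |(((n : ℝ) + 1) ^ N)⁻¹| *
          ∫⁻ x in A, maximalFunction φ f x ^ q := by
        rw [lintegral_const_mul' _ _ (by finiteness),
          setLIntegral_comp_smul volume (fun x => maximalFunction φ f x ^ q) hs,
          finrank_euclideanSpace_fin, mul_assoc]
    _ ≤ ∫⁻ x in A, maximalFunction φ f x ^ q := mul_le_of_le_one_left zero_le hfactor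
    _ = hardyMeasure φ q f A := (withDensity_apply' _ _).symm

theorem integrable_conv_rescaled_rpow (hq0 : 0 < q) (hq1 : q ≤ 1) (hf : f ∈ hardySpace φ q)
    (n : ℕ) : Integrable fun x => |conv (rescaled f n) φ x| ^ q := by
  have := isFiniteMeasure_hardyMeasure hq0 hf
  have hcont : Continuous fun x => |conv (rescaled f n) φ x| ^ q :=
    (continuous_conv _ _).abs.rpow_const fun _ => Or.inr hq0.le
  refine ⟨hcont.aestronglyMeasurable, ?_⟩
  rw [hasFiniteIntegral_iff_ofReal (ae_of_all _ fun x => by positivity)]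
  have hle := setLIntegral_conv_rescaled_rpow_le φ hq0 hq1 f n univ
  rw [preimage_univ, Measure.restrict_univ] at hle
  exact hle.trans_lt (measure_lt_top _ _)

theorem setIntegral_conv_rescaled_rpow_le (hq0 : 0 < q) (hq1 : q ≤ 1) (hf : f ∈ hardySpace φ q)
    (n : ℕ) (A : Set (Space N)) :
    ∫ x in (((n : ℝ) + 1) • ·) ⁻¹' A, |conv (rescaled f n) φ x| ^ q ≤
      (hardyMeasure φ q f).real A := by
  have := isFiniteMeasure_hardyMeasure hq0 hf
  rw [integral_eq_lintegral_of_nonneg_ae (ae_of_all _ fun x => by positivity)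
    (integrable_conv_rescaled_rpow hq0 hq1 hf n).aestronglyMeasurable.restrict]
  exact ENNReal.toReal_mono (measure_ne_top _ _)
    (setLIntegral_conv_rescaled_rpow_le φ hq0 hq1 f n A)

theorem setIntegral_closedBall_conv_rescaled_rpow_le (hq0 : 0 < q) (hq1 : q ≤ 1)
    (hf : f ∈ hardySpace φ q) (n : ℕ) (x : Space N) {r : ℝ} (hr : 0 < r) :
    ∫ y in Metric.closedBall (0 : Space N) 1, |conv (rescaled f n) φ (x + r • y)| ^ q ≤
      (hardyMeasure φ q f).real univ / r ^ N := by
  have hint := integrable_conv_rescaled_rpow hq0 hq1 hf n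
  calc ∫ y in Metric.closedBall (0 : Space N) 1, |conv (rescaled f n) φ (x + r • y)| ^ q
      ≤ ∫ y, |conv (rescaled f n) φ (x + r • y)| ^ q :=
        setIntegral_le_integral ((hint.comp_add_left x).comp_smul hr.ne')
          (ae_of_all _ fun y => by positivity)
    _ = (∫ y, |conv (rescaled f n) φ y| ^ q) / r ^ N := by
        rw [Measure.integral_comp_smul volume (fun y => |conv (rescaled f n) φ (x + y)| ^ q) r,
          finrank_euclideanSpace_fin, abs_of_pos (by positivity), smul_eq_mul,
          integral_add_left_eq_self fun y => |conv (rescaled f n) φ y| ^ q, div_eq_inv_mul]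
    _ ≤ (hardyMeasure φ q f).real univ / r ^ N := by
        gcongr
        simpa only [preimage_univ, Measure.restrict_univ] using
          setIntegral_conv_rescaled_rpow_le hq0 hq1 hf n univ

theorem tendsto_real_compl_closedBall {E : Type*} [NormedAddCommGroup E] [ProperSpace E]
    [MeasurableSpace E] [BorelSpace E] (μ : Measure E) [IsFiniteMeasure μ] (x : E) :
    Tendsto (fun r : ℝ => μ.real (Metric.closedBall x r)ᶜ) atTop (𝓝 0) := by
  have htight := tendsto_measure_compl_closedBall_of_isTightMeasureSet
    (isTightMeasureSet_singleton (μ := μ)) x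
  simp only [mem_singleton_iff, iSup_iSup_eq_left] at htight
  exact (ENNReal.tendsto_toReal ENNReal.zero_ne_top).comp htight

theorem tendsto_integral_conv_rescaled_mul (hq0 : 0 < q) (hq1 : q ≤ 1) (hf : f ∈ hardySpace φ q)
    {B : ℝ} (hB : ∀ n x, |conv (rescaled f n) φ x| ≤ B) {κ : 𝓢(Space N, ℝ)} {ρ : ℝ} (hρ : 0 < ρ)
    (hκ : ∀ x ∈ Metric.closedBall 0 ρ, κ x = 0) :
    Tendsto (fun n => ∫ x, conv (rescaled f n) φ x * κ x) atTop (𝓝 0) := by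
  have := isFiniteMeasure_hardyMeasure hq0 hf
  have hB0 : 0 ≤ B := (abs_nonneg _).trans (hB 0 0)
  let M := B ^ (1 - q) * SchwartzMap.seminorm ℝ 0 0 κ
  have hradius : Tendsto (fun n : ℕ => ((n : ℝ) + 1) * ρ) atTop atTop :=
    (tendsto_atTop_add_const_right _ 1 tendsto_natCast_atTop_atTop).atTop_mul_const hρ
  have htail := ((tendsto_real_compl_closedBall (hardyMeasure φ q f) 0).comp hradius).const_mul M
  rw [mul_zero] at htail
  refine squeeze_zero_norm (fun n => ?_) htail
  have hpre : (((n : ℝ) + 1) • ·) ⁻¹' (Metric.closedBall (0 : Space N) (((n : ℝ) + 1) * ρ))ᶜ =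
      (Metric.closedBall 0 ρ)ᶜ := by
    have hs : 0 < (n : ℝ) + 1 := by positivity
    ext x
    simp [norm_smul, abs_of_pos hs, hs]
  have hint := (integrable_conv_rescaled_rpow hq0 hq1 hf n).integrableOn
    (s := (Metric.closedBall 0 ρ)ᶜ)
  calc ‖∫ x, conv (rescaled f n) φ x * κ x‖
      = ‖∫ x in (Metric.closedBall 0 ρ)ᶜ, conv (rescaled f n) φ x * κ x‖ := by
        rw [setIntegral_eq_integral_of_forall_compl_eq_zero fun x hx => by
          rw [hκ x (notMem_compl_iff.1 hx), mul_zero]]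
    _ ≤ ∫ x in (Metric.closedBall 0 ρ)ᶜ, M * |conv (rescaled f n) φ x| ^ q := by
        refine norm_integral_le_of_norm_le (hint.const_mul M) (ae_of_all _ fun x => ?_)
        rw [norm_mul, Real.norm_eq_abs, mul_right_comm]
        exact mul_le_mul (le_rpow_mul_rpow (abs_nonneg _) (hB n x) hq1)
          (SchwartzMap.norm_le_seminorm ℝ κ x) (norm_nonneg _) (by positivity)
    _ ≤ M * (hardyMeasure φ q f).real (Metric.closedBall 0 (((n : ℝ) + 1) * ρ))ᶜ := by
        rw [integral_const_mul, ← hpre]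
        gcongr
        exact setIntegral_conv_rescaled_rpow_le hq0 hq1 hf n _

end HardyMeasure

namespace SolvesPressureEquation

variable {w : Fin N → Fin N → Space N → ℝ} {f : Tempered N} {φ : 𝓢(Space N, ℝ)} {q : ℝ}

theorem exists_abs_conv_rescaled_le [NeZero N] (h : SolvesPressureEquation w f)
    (hw : ∀ i j, Integrable (w i j)) (hq0 : 0 < q) (hq1 : q ≤ 1) (hf : f ∈ hardySpace φ q) :
    ∃ B, ∀ n x, |conv (rescaled f n) φ x| ≤ B := by
  obtain ⟨C, hC, hmean⟩ := exists_abs_le_integral_closedBall_add (Space N)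
  obtain ⟨K, hlap⟩ := h.exists_abs_conv_rescaled_lap_le hw φ
  refine ⟨_, fun n => abs_le_max_of_integral_rpow_le (μ := volume) (d := N) (K := K)
    (H := (hardyMeasure φ q f).real univ) (continuous_conv _ φ) hC.le
    (Nat.cast_pos.2 (NeZero.pos N)) hq0 hq1 ((abs_nonneg _).trans (hlap 0 0))
    (fun x r hr => hmean _ (contDiff_conv 2 _ φ) _ (fun y => ?_) x r hr.le)
    fun x r hr => ?_⟩
  · rw [laplacian_conv, ← lap_eq_laplacian]
    exact hlap n y
  · rw [Real.rpow_natCast]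
    exact setIntegral_closedBall_conv_rescaled_rpow_le hq0 hq1 hf n x hr

theorem integral_hessComb_mul_eq_zero [NeZero N] (h : SolvesPressureEquation w f)
    (hw : ∀ i j, Integrable (w i j)) (hq0 : 0 < q) (hq1 : q ≤ 1) (hf : f ∈ hardySpace φ q)
    {η : 𝓢(Space N, ℝ)} (hη : HasCompactSupport η) (hη0 : 0 ∉ tsupport η) :
    ∫ x, hessComb (fun i j => ∫ y, w i j y) φ x * η x = 0 := by
  obtain ⟨B, hB⟩ := h.exists_abs_conv_rescaled_le hw hq0 hq1 hf
  obtain ⟨K, hK⟩ := h.exists_abs_conv_rescaled_lap_le hw φ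
  obtain ⟨ρ, hρ, hball⟩ := Metric.nhds_basis_closedBall.mem_iff.1
    ((isClosed_tsupport η).isOpen_compl.mem_nhds hη0)
  have hlap (x : Space N) (hx : x ∈ Metric.closedBall 0 ρ) : lap η x = 0 := by
    simp only [lap, sum_apply]
    exact Finset.sum_eq_zero fun i _ => image_eq_zero_of_notMem_tsupport fun hmem => hball hx
      (SchwartzMap.tsupport_lineDerivOp_subset _ _
        (SchwartzMap.tsupport_lineDerivOp_subset _ _ hmem))
  have hzero := tendsto_integral_conv_rescaled_mul hq0 hq1 hf hB hρ hlap
  simp only [integral_conv_mul_lap _ φ hη] at hzero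
  have hlim : Tendsto (fun n => ∫ x, conv (rescaled f n) (lap φ) x * η x) atTop
      (𝓝 (∫ x, -hessComb (fun i j => ∫ y, w i j y) φ x * η x)) := by
    refine tendsto_integral_of_dominated_convergence (fun x => K * ‖η x‖)
      (fun n => (integrable_conv_mul _ _ hη).aestronglyMeasurable)
      (η.integrable.norm.const_mul _) (fun n => ae_of_all _ fun x => ?_)
      (ae_of_all _ fun x => (h.tendsto_conv_rescaled_lap hw φ x).mul_const _)
    rw [norm_mul]
    gcongr
    exact hK n x
  simpa only [neg_mul, integral_neg, neg_eq_zero] using tendsto_nhds_unique hlim hzero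

theorem hessComb_integral_eq_zero [NeZero N] (h : SolvesPressureEquation w f)
    (hw : ∀ i j, Integrable (w i j)) (hq0 : 0 < q) (hq1 : q ≤ 1) (hf : f ∈ hardySpace φ q) :
    hessComb (fun i j => ∫ y, w i j y) φ = 0 := by
  let g := hessComb (fun i j => ∫ y, w i j y) φ
  have hcompl : ∀ᵐ x : Space N, x ∈ ({0}ᶜ : Set (Space N)) → g x = 0 :=
    by
    refine isOpen_compl_singleton.ae_eq_zero_of_integral_contDiff_smul_eq_zero
      (g.continuous.locallyIntegrable.locallyIntegrableOn _) fun η hη hηc hη0 => ?_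
    simp only [smul_eq_mul, mul_comm (η _)]
    exact h.integral_hessComb_mul_eq_zero hw hq0 hq1 hf (η := hηc.toSchwartzMap hη) hηc
      fun hmem => hη0 hmem rfl
  have hae : g =ᵐ[volume] (0 : Space N → ℝ) := by
    filter_upwards [hcompl, compl_mem_ae_iff.2 (measure_singleton 0)] with x hx hx0 using hx hx0
  exact DFunLike.coe_injective ((g.continuous.ae_eq_iff_eq volume continuous_zero).1 hae)

theorem integral_diag_eq_zero_of_mem_hardySpace (h : SolvesPressureEquation w f)
    (hw : ∀ i j, Integrable (w i j)) (hφ : ∫ x, φ x ≠ 0) (hq0 : 0 < q) (hq1 : q ≤ 1)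
    (hf : f ∈ hardySpace φ q) (k : Fin N) : ∫ x, w k k x = 0 := by
  have : NeZero N := ⟨k.pos.ne'⟩
  exact self_eq_neg.1 (eq_neg_of_add_eq_zero_left
    (add_eq_zero_of_hessComb_eq_zero hφ (h.hessComb_integral_eq_zero hw hq0 hq1 hf) k k))

end SolvesPressureEquation

/-! ### The energy of weak solutions -/

theorem ae_prod_eq_zero_of_ae_ae {α β F : Type*} [MeasurableSpace α] [MeasurableSpace β]
    [NormedAddCommGroup F] {μ : Measure α} {ν : Measure β} [SFinite ν] {u : α × β → F}
    (hu : AEStronglyMeasurable u (μ.prod ν)) (h : ∀ᵐ x ∂μ, ∀ᵐ y ∂ν, u (x, y) = 0) :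
    ∀ᵐ z ∂μ.prod ν, u z = 0 := by
  have hint : ∫⁻ z, ‖u z‖ₑ ∂μ.prod ν = 0 := by
    rw [lintegral_prod _ hu.enorm, lintegral_congr_ae (g := 0), Pi.zero_def, lintegral_zero]
    filter_upwards [h] with x hx
    exact lintegral_eq_zero_of_ae_eq_zero (hx.mono fun y hy => by simp [hy])
  filter_upwards [(lintegral_eq_zero_iff' hu.enorm).1 hint] with z hz using enorm_eq_zero.1 hz

theorem ae_eq_zero_of_integral_mul_self_eq_zero {u : Space N → Space N} (hu : MemLp u 2 volume)
    (h : ∀ k, ∫ x, u x k * u x k = 0) : ∀ᵐ x, u x = 0 := by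
  have hcomp (k : Fin N) : ∀ᵐ x, u x k * u x k = 0 :=
    (integral_eq_zero_iff_of_nonneg (fun x => mul_self_nonneg (u x k))
      (integrable_mul_components hu k k)).1 (h k)
  filter_upwards [ae_all_iff.2 hcomp] with x hx
  ext k
  exact mul_self_eq_zero.1 (hx k)

namespace IsWeakSolution

variable {ν T : ℝ} {v : ℝ → Space N → Space N} {p : ℝ → Tempered N}

theorem ae_eq_zero_of_integral_sq_eq_zero (hsol : IsWeakSolution ν T v p)
    (h : ∀ᵐ t ∂(timeMeasure T), ∀ k, ∫ x, v t x k * v t x k = 0) :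
    ∀ᵐ z ∂((timeMeasure T).prod (volume : Measure (Space N))), v z.1 z.2 = 0 := by
  refine ae_prod_eq_zero_of_ae_ae hsol.memL1L2.1 ?_
  filter_upwards [h, hsol.ae_memLp] with t ht hv
  exact ae_eq_zero_of_integral_mul_self_eq_zero hv ht

theorem ae_integral_mul_eq_of_isL1L1Density (hsol : IsWeakSolution ν T v p)
    {P : ℝ → Space N → ℝ} (hP : IsL1L1Density T p P) :
    ∀ᵐ t ∂(timeMeasure T), ∀ k l : Fin N,
      ∫ x, v t x k * v t x l = if k = l then -∫ x, P t x else 0 := by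
  filter_upwards [hsol.ae_solvesPressureEquation, hsol.ae_memLp,
    ae_memLp_of_memL1Lq one_ne_zero (by simp) hP.1, hP.2] with t hpde hv hPt hp k l
  have hsymm := hpde.integral_add_integral_eq (integrable_mul_components hv)
    (memLp_one_iff_integrable.1 hPt) hp k l
  simp only [mul_comm (v t _ l)] at hsymm
  split_ifs at hsymm ⊢ <;> linarith

theorem ae_integral_sq_eq_zero_of_mem_hardySpace (hsol : IsWeakSolution ν T v p)
    {φ : 𝓢(Space N, ℝ)} (hφ : ∫ x, φ x ≠ 0) {q : ℝ} (hq0 : 0 < q) (hq1 : q ≤ 1)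
    (hp : ∀ᵐ t ∂(timeMeasure T), p t ∈ hardySpace φ q) :
    ∀ᵐ t ∂(timeMeasure T), ∀ k, ∫ x, v t x k * v t x k = 0 := by
  filter_upwards [hsol.ae_solvesPressureEquation, hsol.ae_memLp, hp] with t hpde hv hpt
  exact hpde.integral_diag_eq_zero_of_mem_hardySpace (integrable_mul_components hv) hφ hq0 hq1 hpt

end IsWeakSolution

end

end NavierStokes

theorem theorem1p1 (N : ℕ) (hN : 2 ≤ N) (T : ℝ) (hT : 0 < T) (ν : ℝ) (hν : 0 ≤ ν)
    (φ : 𝓢(Space N, ℝ)) (hφ : (∫ x, φ x) ≠ 0)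
    (v : ℝ → Space N → Space N) (p : ℝ → Tempered N) (hsol : IsWeakSolution ν T v p) :
    (((∃ P : ℝ → Space N → ℝ, IsL1L1Density T p P ∧
          ∀ᵐ t ∂(timeMeasure T), 0 ≤ ∫ x, P t x) ∨
        (∃ q : ℝ, 0 < q ∧ q ≤ 1 ∧ MemL1Hardy φ q T p)) →
      ∀ᵐ z ∂((timeMeasure T).prod (volume : Measure (Space N))), v z.1 z.2 = 0) ∧
    (∀ P : ℝ → Space N → ℝ, IsL1L1Density T p P →
      (∀ᵐ t ∂(timeMeasure T), (∫ x, P t x) ≤ 0) →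
      ∀ᵐ t ∂(timeMeasure T),
        (∀ j, energy v j t = -(1 / 2) * ∫ x, P t x) ∧
        (∀ j k, j ≠ k → (∫ x, v t x j * v t x k) = 0)) := by
  refine ⟨fun h => hsol.ae_eq_zero_of_integral_sq_eq_zero ?_, fun P hP _ => ?_⟩
  · rcases h with ⟨P, hP, hnonneg⟩ | ⟨q, hq0, hq1, -, hmem, -⟩
    · filter_upwards [hsol.ae_integral_mul_eq_of_isL1L1Density hP, hnonneg] with t ht hPt k
      have henergy : 0 ≤ ∫ x, v t x k * v t x k := integral_nonneg fun x => mul_self_nonneg _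
      rw [ht k k, if_pos rfl] at henergy ⊢
      linarith
    · exact hsol.ae_integral_sq_eq_zero_of_mem_hardySpace hφ hq0 hq1 hmem
  · filter_upwards [hsol.ae_integral_mul_eq_of_isL1L1Density hP] with t ht
    refine ⟨fun j => ?_, fun j k hjk => by rw [ht j k, if_neg hjk]⟩
    simp only [energy, sq, ht j j, if_pos]
    ring
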